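/- Consider the linear relaxation system $U_t+\sum_{j=1}^d A_jU_{x_j}=QU/\epsilon$ in $x_1>0$ with boundary condition $BU=b$ at $x_1=0$, where $U\in\mathbb R^n$, the real $n\times n$ matrices $A_j$ are symmetric, $Q=\mathrm{diag}(0_{n-r},S)$ with $S$ a symmetric negative definite $r\times r$ matrix, $A_1$ is invertible, and $B=(B_u,B_v)$ is a full-rank real $n^+\times n$ matrix. Write $A_1=\begin{pmatrix}A_{11}&A_{12}\\A_{12}^*&A_{22}\end{pmatrix}$ in the partition of $Q$ ($*$ denotes the transpose of a real matrix and the conjugate transpose of a complex one) and assume that $A_{11}$ has the eigenvalue $0$. Let $n^+$ and $n_1^+$ be the numbers of positive eigenvalues of $A_1$ and $A_{11}$, and $n_1^o$ the multiplicity of the eigenvalue $0$ of $A_{11}$. A right-stable matrix of a square matrix $M$ with exactly $k$ eigenvalues of negative real part (with multiplicity) is a matrix $R$ with $k$ linearly independent columns such that $MR=RE$ for a $k\times k$ matrix $E$ all of whose eigenvalues have negative real part; right-unstable matrices (positive real parts) and left-unstable matrices (rows, $LM=EL$) are defined likewise. Assume the Generalized Kreiss Condition (GKC): there is $c_K>0$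 such that for all $\eta\ge 0$, $\omega=(\omega_2,\dots,\omega_d)\in\mathbb R^{d-1}$ and $\xi\in\mathbb C$ with $\mathrm{Re}\,\xi>0$, every right-stable matrix $R$ of $M(\xi,\omega,\eta)=A_1^{-1}\big(\eta Q-\xi I_n-i\sum_{j=2}^d\omega_jA_j\big)$ (an $n\times n^+$ matrix) satisfies $|\det(BR)|\ge c_K\sqrt{\det(R^*R)}$. Let $(P_1,P_0)$ be an orthonormal matrix with $(P_1,P_0)^*A_{11}(P_1,P_0)=\mathrm{diag}(\Lambda_1,0)$, where $\Lambda_1$ is an invertible diagonal matrix and $P_0$ has $n_1^o$ columns. Let $P_1^S$ and $P_1^U$ be a right-stable and a right-unstable matrix of $A_{11}$. Put $K=A_{12}^*P_0$ and $A=A_{22}-A_{12}^*P_1\Lambda_1^{-1}P_1^*A_{12}$, let $\tilde K$ be a matrix such that $(K,\tilde K)$ is invertible and $\tilde K^*K=0$, put $$N=-P_1\Lambda_1^{-1}P_1^*A_{12}\tilde K+P_0(K^*K)^{-1}\big[(K^*S\tilde K)(\tilde K^*S\tilde K)^{-1}(\tilde K^*A\tilde K)-K^*A\tilde K\big],$$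 and let $L_2^U$ be a left-unstable matrix of $(\tilde K^*A\tilde K)^{-1}(\tilde K^*S\tilde K)$. Then the matrix $$D=\begin{pmatrix}B_uP_1^U&B_uP_0&B_uN+B_v\tilde K\\0&0&L_2^U\end{pmatrix}$$ is a square matrix of size $(n_1^++r)\times(n_1^++r)$ and is invertible. Hence the boundary conditions for the expansion coefficients are uniquely solvable: for all vectors $b\in\mathbb R^{n^+}$, $\alpha^S$ and $\alpha^0$ (of the sizes for which $P_1^S\alpha^S$ and $P_0\alpha^0$ make sense) there is exactly one triple $(\alpha^U,\mu,w)\in\mathbb R^{n_1^+}\times\mathbb R^{n_1^o}\times\mathbb R^{r-n_1^o}$ such that $$D\begin{pmatrix}\alpha^U\\\mu\\w\end{pmatrix}=\begin{pmatrix}b-B_uP_1^S\alpha^S-B_uP_0\alpha^0\\0\end{pmatrix}.$$ Here $\alpha^U$ are the incoming modes of the equilibrium system, $\mu$ is the boundary value $P_0^*\mu_1$ of the $\sqrt\epsilon$-layer, and $w$ is the initial value of the $\epsilon$-layer. -/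

import Mathlib

open Matrix

noncomputable section

/-- A (possibly rectangular) real matrix is invertible if it has a two-sided inverse.
For a square matrix this is invertibility in the usual sense; it forces as many rows as columns. -/
def IsInvertibleMatrix {ι κ : Type*} [Fintype ι] [DecidableEq ι] [Fintype κ] [DecidableEq κ]
    (D : Matrix ι κ ℝ) : Prop :=
  ∃ X : Matrix κ ι ℝ, D * X = 1 ∧ X * D = 1

/-- The complex eigenvalues of a real or complex square matrix, with algebraic multiplicity. -/
def complexEigenvalues {ι 𝕜 : Type*} [Fintype ι] [DecidableEq ι] [Field 𝕜] [Algebra 𝕜 ℂ]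
    (M : Matrix ι ι 𝕜) : Multiset ℂ :=
  (M.map (algebraMap 𝕜 ℂ)).charpoly.roots

/-- All eigenvalues have negative real part. -/
def IsStableMatrix {ι 𝕜 : Type*} [Fintype ι] [DecidableEq ι] [Field 𝕜] [Algebra 𝕜 ℂ]
    (M : Matrix ι ι 𝕜) : Prop :=
  ∀ z ∈ complexEigenvalues M, z.re < 0

/-- All eigenvalues have positive real part. -/
def IsUnstableMatrix {ι 𝕜 : Type*} [Fintype ι] [DecidableEq ι] [Field 𝕜] [Algebra 𝕜 ℂ]
    (M : Matrix ι ι 𝕜) : Prop :=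
  ∀ z ∈ complexEigenvalues M, 0 < z.re

open Classical in
/-- Number of stable eigenvalues, with multiplicity. -/
def numStable {ι 𝕜 : Type*} [Fintype ι] [DecidableEq ι] [Field 𝕜] [Algebra 𝕜 ℂ]
    (M : Matrix ι ι 𝕜) : ℕ :=
  (complexEigenvalues M).countP (fun z => z.re < 0)

open Classical in
/-- Number of unstable eigenvalues, with multiplicity. -/
def numUnstable {ι 𝕜 : Type*} [Fintype ι] [DecidableEq ι] [Field 𝕜] [Algebra 𝕜 ℂ]
    (M : Matrix ι ι 𝕜) : ℕ :=
  (complexEigenvalues M).countP (fun z => 0 < z.re)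

/-- `R` is a right-stable matrix of `M`: it has as many columns as `M` has stable eigenvalues,
the columns are linearly independent, and `M R = R E` with `E` a stable matrix. -/
def IsRightStable {ι 𝕜 : Type*} [Fintype ι] [DecidableEq ι] [Field 𝕜] [Algebra 𝕜 ℂ] {k : ℕ}
    (M : Matrix ι ι 𝕜) (R : Matrix ι (Fin k) 𝕜) : Prop :=
  k = numStable M ∧ LinearIndependent 𝕜 R.col ∧
    ∃ E : Matrix (Fin k) (Fin k) 𝕜, IsStableMatrix E ∧ M * R = R * E

/-- `R` is a right-unstable matrix of `M`. -/
def IsRightUnstable {ι 𝕜 : Type*} [Fintype ι] [DecidableEq ι] [Field 𝕜] [Algebra 𝕜 ℂ] {k : ℕ}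
    (M : Matrix ι ι 𝕜) (R : Matrix ι (Fin k) 𝕜) : Prop :=
  k = numUnstable M ∧ LinearIndependent 𝕜 R.col ∧
    ∃ E : Matrix (Fin k) (Fin k) 𝕜, IsUnstableMatrix E ∧ M * R = R * E

/-- `L` is a left-unstable matrix of `M`: as many rows as `M` has unstable eigenvalues,
the rows are linearly independent, and `L M = E L` with `E` an unstable matrix. -/
def IsLeftUnstable {ι 𝕜 : Type*} [Fintype ι] [DecidableEq ι] [Field 𝕜] [Algebra 𝕜 ℂ] {k : ℕ}
    (M : Matrix ι ι 𝕜) (L : Matrix (Fin k) ι 𝕜) : Prop :=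
  k = numUnstable M ∧ LinearIndependent 𝕜 L.row ∧
    ∃ E : Matrix (Fin k) (Fin k) 𝕜, IsUnstableMatrix E ∧ L * M = E * L

open Classical in
/-- Number of positive (real) eigenvalues of a real matrix, with multiplicity. -/
def numPosEigenvalues {ι : Type*} [Fintype ι] [DecidableEq ι] (M : Matrix ι ι ℝ) : ℕ :=
  M.charpoly.roots.countP (fun x => 0 < x)

/-- Multiplicity of the eigenvalue zero of a real matrix. -/
def numZeroEigenvalues {ι : Type*} [Fintype ι] [DecidableEq ι] (M : Matrix ι ι ℝ) : ℕ :=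
  M.charpoly.roots.count 0

/-- The source matrix `Q = diag(0, S)`. -/
def sourceMatrix {m r : ℕ} (S : Matrix (Fin r) (Fin r) ℝ) :
    Matrix (Fin m ⊕ Fin r) (Fin m ⊕ Fin r) ℝ :=
  fromBlocks 0 0 0 S

/-- `M(ξ, ω, η) = A₁⁻¹ (η Q - ξ I - i ∑ⱼ ωⱼ Aⱼ)`, where `Aj` lists the coefficient matrices of
the `d'` tangential directions. -/
def symbolM {m r d' : ℕ} (A1 : Matrix (Fin m ⊕ Fin r) (Fin m ⊕ Fin r) ℝ)
    (Aj : Fin d' → Matrix (Fin m ⊕ Fin r) (Fin m ⊕ Fin r) ℝ) (S : Matrix (Fin r) (Fin r) ℝ)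
    (ξ : ℂ) (ω : Fin d' → ℝ) (η : ℝ) : Matrix (Fin m ⊕ Fin r) (Fin m ⊕ Fin r) ℂ :=
  (A1.map Complex.ofReal)⁻¹ *
    ((η : ℂ) • (sourceMatrix S).map Complex.ofReal - ξ • 1
      - Complex.I • ∑ j, (ω j : ℂ) • (Aj j).map Complex.ofReal)

/-- The Generalized Kreiss Condition. The inequality does not depend on which right-stable
matrix `R` of `M(ξ, ω, η)` is used; `det (Rᴴ R)` is a nonnegative real number. -/
def GKC {m r d' np : ℕ} (A1 : Matrix (Fin m ⊕ Fin r) (Fin m ⊕ Fin r) ℝ)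
    (Aj : Fin d' → Matrix (Fin m ⊕ Fin r) (Fin m ⊕ Fin r) ℝ) (S : Matrix (Fin r) (Fin r) ℝ)
    (B : Matrix (Fin np) (Fin m ⊕ Fin r) ℝ) : Prop :=
  ∃ cK : ℝ, 0 < cK ∧ ∀ (η : ℝ) (ω : Fin d' → ℝ) (ξ : ℂ), 0 ≤ η → 0 < ξ.re →
    ∀ R : Matrix (Fin m ⊕ Fin r) (Fin np) ℂ, IsRightStable (symbolM A1 Aj S ξ ω η) R →
      cK * Real.sqrt (Rᴴ * R).det.re ≤ ‖(B.map Complex.ofReal * R).det‖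

/-- `(P₁, P₀)` is an orthonormal matrix with
`(P₁, P₀)ᵀ A₁₁ (P₁, P₀) = diag(Λ₁, 0)` and `Λ₁` an invertible diagonal matrix. -/
def IsEigenSplitting {m p n1o : ℕ} (A11 : Matrix (Fin m) (Fin m) ℝ)
    (P1 : Matrix (Fin m) (Fin p) ℝ) (P0 : Matrix (Fin m) (Fin n1o) ℝ) (Λ1 : Fin p → ℝ) : Prop :=
  (fromCols P1 P0)ᵀ * fromCols P1 P0 = 1 ∧ fromCols P1 P0 * (fromCols P1 P0)ᵀ = 1 ∧
    (fromCols P1 P0)ᵀ * A11 * fromCols P1 P0 = fromBlocks (diagonal Λ1) 0 0 0 ∧ ∀ i, Λ1 i ≠ 0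

/-- `K = A₁₂ᵀ P₀`. -/
def matK {m r n1o : ℕ} (A1 : Matrix (Fin m ⊕ Fin r) (Fin m ⊕ Fin r) ℝ)
    (P0 : Matrix (Fin m) (Fin n1o) ℝ) : Matrix (Fin r) (Fin n1o) ℝ :=
  A1.toBlocks₁₂ᵀ * P0

/-- `A = A₂₂ - A₁₂ᵀ P₁ Λ₁⁻¹ P₁ᵀ A₁₂`. -/
def matA {m r p : ℕ} (A1 : Matrix (Fin m ⊕ Fin r) (Fin m ⊕ Fin r) ℝ)
    (P1 : Matrix (Fin m) (Fin p) ℝ) (Λ1 : Fin p → ℝ) : Matrix (Fin r) (Fin r) ℝ :=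
  A1.toBlocks₂₂ - A1.toBlocks₁₂ᵀ * P1 * (diagonal Λ1)⁻¹ * P1ᵀ * A1.toBlocks₁₂

/-- `N = -P₁ Λ₁⁻¹ P₁ᵀ A₁₂ K̃ + P₀ (KᵀK)⁻¹ [(Kᵀ S K̃)(K̃ᵀ S K̃)⁻¹(K̃ᵀ A K̃) - Kᵀ A K̃]`,
with `Kt` for `K̃`. -/
def matN {m r p n1o s : ℕ} (A1 : Matrix (Fin m ⊕ Fin r) (Fin m ⊕ Fin r) ℝ)
    (S : Matrix (Fin r) (Fin r) ℝ) (P1 : Matrix (Fin m) (Fin p) ℝ)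
    (P0 : Matrix (Fin m) (Fin n1o) ℝ) (Λ1 : Fin p → ℝ) (Kt : Matrix (Fin r) (Fin s) ℝ) :
    Matrix (Fin m) (Fin s) ℝ :=
  -(P1 * (diagonal Λ1)⁻¹ * P1ᵀ * A1.toBlocks₁₂ * Kt) +
    P0 * ((matK A1 P0)ᵀ * matK A1 P0)⁻¹ *
      (((matK A1 P0)ᵀ * S * Kt) * (Ktᵀ * S * Kt)⁻¹ * (Ktᵀ * matA A1 P1 Λ1 * Kt)
        - (matK A1 P0)ᵀ * matA A1 P1 Λ1 * Kt)

/-- The coefficient matrix `(K̃ᵀ A K̃)⁻¹ (K̃ᵀ S K̃)` of the equation for `w`. -/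
def layerMatrix {m r p s : ℕ} (A1 : Matrix (Fin m ⊕ Fin r) (Fin m ⊕ Fin r) ℝ)
    (S : Matrix (Fin r) (Fin r) ℝ) (P1 : Matrix (Fin m) (Fin p) ℝ) (Λ1 : Fin p → ℝ)
    (Kt : Matrix (Fin r) (Fin s) ℝ) : Matrix (Fin s) (Fin s) ℝ :=
  (Ktᵀ * matA A1 P1 Λ1 * Kt)⁻¹ * (Ktᵀ * S * Kt)

/-- The matrix with block rows `(B_u P₁ᵁ, B_u P₀, B_u N + B_v K̃)` and `(0, 0, L₂ᵁ)`. -/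
def boundaryMatrix {m r np n1p n1o s q : ℕ} (B : Matrix (Fin np) (Fin m ⊕ Fin r) ℝ)
    (P1U : Matrix (Fin m) (Fin n1p) ℝ) (P0 : Matrix (Fin m) (Fin n1o) ℝ)
    (N : Matrix (Fin m) (Fin s) ℝ) (Kt : Matrix (Fin r) (Fin s) ℝ)
    (L2U : Matrix (Fin q) (Fin s) ℝ) :
    Matrix (Fin np ⊕ Fin q) (Fin n1p ⊕ (Fin n1o ⊕ Fin s)) ℝ :=
  fromRows
    (fromCols (B.toCols₁ * P1U) (fromCols (B.toCols₁ * P0) (B.toCols₁ * N + B.toCols₂ * Kt)))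
    (fromCols 0 (fromCols 0 L2U))

end

/-!
Suppose `D` annihilates `(α, μ, w)`, and let `x = (P₁ᵁ α + P₀ μ + N w, K̃ w)` be the boundary value
assembled from the three modes. Then `B x = 0`, and `L₂ᵁ w = 0` says that `w` lies in the stable
subspace of the layer equation. The Generalized Kreiss Condition makes `B` injective, uniformly, on
the stable subspaces `E(ξ)` of `A₁⁻¹ (Q - ξ I)` for `ξ > 0`, so it suffices to show that `x` is a
limit of vectors of `E(ξ)` as `ξ → 0`, and that the space `limitStable` of all such limits has
dimension `n⁺` (`GKC.eq_zero_of_mem_limitStable`).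

Limits are found through approximate eigenvectors. `A₁` and `H = ξ I - Q` are diagonalized
simultaneously. If `y` satisfies `lam A₁ y + H y = e` with `lam < 0`, pairing with the unstable part
`z` of `y` gives `zᵀ H z ≤ zᵀ e`, since `A₁` is nonpositive on the unstable subspace. With
`ξ = τ ^ 2` this forces `z → 0` as soon as the conserved part of `e` is `o(τ ^ 2)` and the relaxing
part is `o(τ)` (`mem_limitStable_of_residual`). The three kinds of modes are obtained with `lam` of
order `τ ^ 2`, `τ` and `1`: eigenvectors of `A₁₁` with positive eigenvalue, the kernel of `A₁₁` (via
the eigenvectors of `Kᵀ (-S)⁻¹ K`), and the stable eigenvectors of the layer equation.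

The form of `A₁` is nonnegative on `limitStable`, so the inertia of `A₁` bounds its dimension by
`n⁺`. The modes found give a lower bound. The same two bounds for `-A₁` add up with these to the
same total, whence all of them are equalities (`IsLayerFrame.finrank_limitStable_eq`). This also
yields `n⁺ + q = n₁⁺ + r`, i.e. that `D` is square.
-/

open Filter Topology

/-! ### Diagonalization of a pair of symmetric matrices -/

theorem isSymm_transpose_mul_mul {ι κ : Type*} [Fintype ι] {A : Matrix ι ι ℝ}
    (hA : A.IsSymm) (W : Matrix ι κ ℝ) : (Wᵀ * A * W).IsSymm := by
  rw [Matrix.IsSymm, transpose_mul, transpose_mul, transpose_transpose, hA.eq, Matrix.mul_assoc]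

theorem mulVec_dotProduct_mulVec {ι κ : Type*} [Fintype ι] [Fintype κ] (A : Matrix ι ι ℝ)
    (W : Matrix ι κ ℝ) (c d : κ → ℝ) : (W *ᵥ c) ⬝ᵥ (A *ᵥ (W *ᵥ d)) = c ⬝ᵥ ((Wᵀ * A * W) *ᵥ d) := by
  rw [← mulVec_mulVec, ← mulVec_mulVec, dotProduct_mulVec c Wᵀ, vecMul_transpose]

theorem exists_orthogonal_diagonalization {ι : Type*} [Fintype ι] [DecidableEq ι]
    {A : Matrix ι ι ℝ} (hA : A.IsSymm) :
    ∃ (U : Matrix ι ι ℝ) (δ : ι → ℝ), Uᵀ * U = 1 ∧ Uᵀ * A * U = diagonal δ := by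
  have hA' : A.IsHermitian := by
    rw [Matrix.IsHermitian, conjTranspose_eq_transpose_of_trivial]; exact hA
  refine ⟨hA'.eigenvectorUnitary, hA'.eigenvalues, ?_, ?_⟩
  · have := (Matrix.mem_unitaryGroup_iff').1 hA'.eigenvectorUnitary.2
    rwa [star_eq_conjTranspose, conjTranspose_eq_transpose_of_trivial] at this
  · have := hA'.conjStarAlgAut_star_eigenvectorUnitary
    rw [Unitary.conjStarAlgAut_apply] at this
    simpa [star_eq_conjTranspose, conjTranspose_eq_transpose_of_trivial, Function.comp_def]
      using this

theorem exists_simultaneous_diagonalization {ι : Type*} [Fintype ι] [DecidableEq ι]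
    {A H : Matrix ι ι ℝ} (hA : A.IsSymm) (hH : H.PosDef) :
    ∃ (V : Matrix ι ι ℝ) (δ : ι → ℝ), Vᵀ * H * V = 1 ∧ Vᵀ * A * V = diagonal δ := by
  have hHs : H.IsSymm := by
    have := hH.isHermitian
    rwa [Matrix.IsHermitian, conjTranspose_eq_transpose_of_trivial] at this
  obtain ⟨U, e, hU, he⟩ := exists_orthogonal_diagonalization hHs
  have hpos : ∀ i, 0 < e i := by
    have h1 : (Uᵀ * H * U).PosDef := by
      have := hH.conjTranspose_mul_mul_same (B := U) (by
        apply Function.LeftInverse.injective (g := fun x => Uᵀ *ᵥ x)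
        intro x; simp [hU])
      rwa [conjTranspose_eq_transpose_of_trivial] at this
    rw [he] at h1
    exact Matrix.posDef_diagonal_iff.1 h1
  set W := U * diagonal (fun i => (Real.sqrt (e i))⁻¹) with hW
  have hWH : Wᵀ * H * W = 1 := by
    have : Wᵀ * H * W = diagonal (fun i => (Real.sqrt (e i))⁻¹) * (Uᵀ * H * U) *
        diagonal (fun i => (Real.sqrt (e i))⁻¹) := by
      rw [hW, transpose_mul, diagonal_transpose]; simp only [Matrix.mul_assoc]
    rw [this, he, diagonal_mul_diagonal, diagonal_mul_diagonal, ← diagonal_one]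
    congr 1; funext i
    have h2 := Real.mul_self_sqrt (hpos i).le
    have h3 : Real.sqrt (e i) ≠ 0 := (Real.sqrt_pos.2 (hpos i)).ne'
    field_simp
    nlinarith
  obtain ⟨U', δ, hU', hδ⟩ :=
    exists_orthogonal_diagonalization (isSymm_transpose_mul_mul hA W)
  refine ⟨W * U', δ, ?_, ?_⟩
  · calc (W * U')ᵀ * H * (W * U') = U'ᵀ * (Wᵀ * H * W) * U' := by
          rw [transpose_mul]; simp only [Matrix.mul_assoc]
      _ = 1 := by rw [hWH, Matrix.mul_one, hU']
  · rw [← hδ, transpose_mul]; simp only [Matrix.mul_assoc]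

section Congruence

variable {ι : Type*} [Fintype ι] [DecidableEq ι] {A H V : Matrix ι ι ℝ} {δ : ι → ℝ}

theorem mul_congruence_eq_one (hH : Vᵀ * H * V = 1) : V * (Vᵀ * H) = 1 :=
  mul_eq_one_comm.1 hH

/-- Multiplying by `V⁻ᵀ = H V`, the congruence `Vᵀ A V = diag δ` becomes `A V = H V diag δ`. -/
theorem mul_eq_of_congruence (hH : Vᵀ * H * V = 1) (hA : Vᵀ * A * V = diagonal δ) :
    A * V = H * V * diagonal δ := by
  have h1 : H * V * Vᵀ = 1 := by
    rw [← mul_eq_one_comm, ← Matrix.mul_assoc]; exact hH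
  rw [← hA, ← Matrix.mul_assoc, ← Matrix.mul_assoc, h1, Matrix.one_mul]

theorem dotProduct_mulVec_of_congruence (hA : Vᵀ * A * V = diagonal δ) (c d : ι → ℝ) :
    (V *ᵥ c) ⬝ᵥ (A *ᵥ (V *ᵥ d)) = ∑ i, δ i * (c i * d i) := by
  rw [mulVec_dotProduct_mulVec, hA, dotProduct]
  refine Finset.sum_congr rfl fun i _ => ?_
  rw [mulVec_diagonal]; ring

theorem ne_zero_of_congruence (hAu : IsUnit A) (hV : IsUnit V)
    (hA : Vᵀ * A * V = diagonal δ) (i : ι) : δ i ≠ 0 := by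
  have h : IsUnit (diagonal δ) := by
    rw [← hA]; exact (((isUnit_transpose V).2 hV).mul hAu).mul hV
  rw [Matrix.isUnit_diagonal, Pi.isUnit_iff] at h
  exact (h i).ne_zero

theorem isUnit_of_congruence_one (hH : Vᵀ * H * V = 1) : IsUnit V :=
  IsUnit.of_mul_eq_one _ (mul_congruence_eq_one hH)

end Congruence

/-! ### Counting eigenvalues -/

theorem roots_charpoly_diagonal {ι 𝕜 : Type*} [Fintype ι] [DecidableEq ι] [Field 𝕜] (δ : ι → 𝕜) :
    (diagonal δ).charpoly.roots = Finset.univ.val.map δ := by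
  rw [charpoly_diagonal, Polynomial.roots_prod _ _ (Finset.prod_ne_zero_iff.2 fun i _ =>
    Polynomial.X_sub_C_ne_zero _)]
  simp

theorem charpoly_eq_of_mul_eq {ι R : Type*} [Fintype ι] [DecidableEq ι] [CommRing R]
    {M V N : Matrix ι ι R} (hV : IsUnit V) (h : M * V = V * N) : M.charpoly = N.charpoly := by
  obtain ⟨U, rfl⟩ := hV
  rw [← charpoly_units_conj U N, ← h, Matrix.mul_assoc]
  simp

theorem countP_map_univ {ι α : Type*} [Fintype ι] (f : ι → α) (P : α → Prop) [DecidablePred P]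
    [Fintype {i // P (f i)}] :
    (Finset.univ.val.map f).countP P = Fintype.card {i // P (f i)} := by
  rw [Multiset.countP_map, Fintype.card_subtype]
  rfl

theorem numPosEigenvalues_of_mul_eq {ι : Type*} [Fintype ι] [DecidableEq ι]
    {M V : Matrix ι ι ℝ} {δ : ι → ℝ} (hV : IsUnit V) (h : M * V = V * diagonal δ) :
    numPosEigenvalues M = Fintype.card {i // 0 < δ i} := by
  classical
  rw [numPosEigenvalues, charpoly_eq_of_mul_eq hV h, roots_charpoly_diagonal]
  convert countP_map_univ δ (fun x => 0 < x)

theorem complexEigenvalues_of_mul_eq {ι 𝕜 : Type*} [Fintype ι] [DecidableEq ι] [Field 𝕜]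
    [Algebra 𝕜 ℂ] {M V : Matrix ι ι 𝕜} {δ : ι → 𝕜} (hV : IsUnit V) (h : M * V = V * diagonal δ) :
    complexEigenvalues M = Finset.univ.val.map fun i => algebraMap 𝕜 ℂ (δ i) := by
  rw [complexEigenvalues, charpoly_map, charpoly_eq_of_mul_eq hV h, ← charpoly_map, diagonal_map
    (map_zero _), roots_charpoly_diagonal]

theorem card_pos_add_card_neg {ι : Type*} [Fintype ι] {δ : ι → ℝ} (h : ∀ i, δ i ≠ 0) :
    Fintype.card {i // 0 < δ i} + Fintype.card {i // δ i < 0} = Fintype.card ι := by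
  classical
  have h1 : Fintype.card {i // δ i < 0} = Fintype.card {i // ¬ 0 < δ i} :=
    Fintype.card_congr (Equiv.subtypeEquivRight fun i =>
      ⟨fun h1 => h1.not_gt, fun h1 => lt_of_le_of_ne (not_lt.1 h1) (h i)⟩)
  rw [h1, Fintype.card_subtype_compl]
  exact Nat.add_sub_cancel' (Fintype.card_subtype_le _)

/-! ### Inertia of a symmetric matrix -/

theorem numPosEigenvalues_add_neg {ι : Type*} [Fintype ι] [DecidableEq ι] {A : Matrix ι ι ℝ}
    (hA : A.IsSymm) (hAu : IsUnit A) :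
    numPosEigenvalues A + numPosEigenvalues (-A) = Fintype.card ι := by
  obtain ⟨U, δ, hU, hδ⟩ := exists_orthogonal_diagonalization hA
  have hU1 : Uᵀ * (1 : Matrix ι ι ℝ) * U = 1 := by rwa [Matrix.mul_one]
  have hUu := isUnit_of_congruence_one hU1
  have h1 := mul_eq_of_congruence hU1 hδ
  rw [Matrix.one_mul] at h1
  have h2 : -A * U = U * diagonal (fun i => -δ i) := by
    rw [Matrix.neg_mul, h1, ← Matrix.mul_neg, diagonal_neg]
  rw [numPosEigenvalues_of_mul_eq hUu h1, numPosEigenvalues_of_mul_eq hUu h2,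
    ← card_pos_add_card_neg (ne_zero_of_congruence hAu hUu hδ)]
  simp

/-- A subspace on which the form of an invertible symmetric matrix is nonnegative meets the span
of the negative eigenvectors only in `0`. -/
theorem finrank_le_numPosEigenvalues {ι E : Type*} [Fintype ι] [DecidableEq ι] [AddCommGroup E]
    [Module ℝ E] {A : Matrix ι ι ℝ} (hA : A.IsSymm) (hAu : IsUnit A)
    (f : E →ₗ[ℝ] ι → ℝ) (hf : Function.Injective f) (hnn : ∀ x, 0 ≤ f x ⬝ᵥ (A *ᵥ f x)) :
    Module.finrank ℝ E ≤ numPosEigenvalues A := by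
  obtain ⟨U, δ, hU, hδ⟩ := exists_orthogonal_diagonalization hA
  have hU1 : Uᵀ * (1 : Matrix ι ι ℝ) * U = 1 := by rwa [Matrix.mul_one]
  have hUu := isUnit_of_congruence_one hU1
  have hUU : U * Uᵀ = 1 := mul_eq_one_comm.1 hU
  have h1 := mul_eq_of_congruence hU1 hδ
  rw [Matrix.one_mul] at h1
  rw [numPosEigenvalues_of_mul_eq hUu h1]
  let g : E →ₗ[ℝ] ({i // 0 < δ i} → ℝ) :=
    LinearMap.funLeft ℝ ℝ Subtype.val ∘ₗ Uᵀ.mulVecLin ∘ₗ f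
  have hg : Function.Injective g := by
    rw [← LinearMap.ker_eq_bot, LinearMap.ker_eq_bot']
    intro x hx
    set c := Uᵀ *ᵥ f x with hc
    have hfc : f x = U *ᵥ c := by rw [hc, mulVec_mulVec, hUU, one_mulVec]
    have hc0 : ∀ i, 0 < δ i → c i = 0 := fun i hi => congrFun hx ⟨i, hi⟩
    have h2 := hnn x
    rw [hfc, dotProduct_mulVec_of_congruence hδ] at h2
    have h3 : ∀ i ∈ Finset.univ, δ i * (c i * c i) ≤ 0 := by
      intro i _
      rcases lt_or_ge 0 (δ i) with hi | hi
      · simp [hc0 i hi]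
      · exact mul_nonpos_of_nonpos_of_nonneg hi (mul_self_nonneg _)
    have h4 := (Finset.sum_eq_zero_iff_of_nonpos h3).1 (le_antisymm (Finset.sum_nonpos h3) h2)
    have h5 : c = 0 := by
      funext i
      have := h4 i (Finset.mem_univ i)
      simpa [ne_zero_of_congruence hAu hUu hδ i] using this
    apply hf
    rw [hfc, h5, mulVec_zero, map_zero]
  have := LinearMap.finrank_le_finrank_of_injective hg
  rwa [Module.finrank_fintype_fun_eq_card] at this

theorem card_le_numPosEigenvalues_of_congruence {ι : Type*} [Fintype ι] [DecidableEq ι]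
    {A V : Matrix ι ι ℝ} {δ : ι → ℝ} (hA : A.IsSymm) (hAu : IsUnit A) (hV : IsUnit V)
    (h : Vᵀ * A * V = diagonal δ) :
    Fintype.card {i // 0 < δ i} ≤ numPosEigenvalues A := by
  obtain ⟨T, hT⟩ := hV.exists_left_inv
  let W : Matrix ι {i // 0 < δ i} ℝ := V.submatrix id Subtype.val
  have hW : Function.Injective W.mulVecLin := by
    apply Function.LeftInverse.injective (g := fun x => (T.submatrix Subtype.val id) *ᵥ x)
    intro x
    have : T.submatrix (Subtype.val : {i // 0 < δ i} → ι) id * W = 1 := by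
      rw [← submatrix_mul T V _ id _ Function.bijective_id, hT,
        submatrix_one _ Subtype.val_injective]
    simp [this]
  have hWA : Wᵀ * A * W = diagonal fun i => δ i.1 := by
    have : Wᵀ * A * W = (Vᵀ * A * V).submatrix Subtype.val Subtype.val := by
      rw [submatrix_mul _ _ _ id _ Function.bijective_id,
        submatrix_mul _ _ _ id _ Function.bijective_id]
      rfl
    rw [this, h, submatrix_diagonal _ _ Subtype.val_injective]
    rfl
  have := finrank_le_numPosEigenvalues hA hAu W.mulVecLin hW fun x => by
    rw [mulVecLin_apply, mulVec_dotProduct_mulVec, hWA]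
    refine Finset.sum_nonneg fun i _ => ?_
    rw [mulVec_diagonal]
    nlinarith [i.2, mul_self_nonneg (x i), mul_nonneg i.2.le (mul_self_nonneg (x i))]
  rwa [Module.finrank_fintype_fun_eq_card] at this

/-- **Sylvester's law of inertia** for invertible symmetric matrices. -/
theorem numPosEigenvalues_eq_card_of_congruence {ι : Type*} [Fintype ι] [DecidableEq ι]
    {A V : Matrix ι ι ℝ} {δ : ι → ℝ} (hA : A.IsSymm) (hAu : IsUnit A) (hV : IsUnit V)
    (h : Vᵀ * A * V = diagonal δ) :
    numPosEigenvalues A = Fintype.card {i // 0 < δ i} := by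
  have h1 := card_le_numPosEigenvalues_of_congruence hA hAu hV h
  have h2 := card_le_numPosEigenvalues_of_congruence (A := -A) (δ := fun i => -δ i) hA.neg hAu.neg
    hV (by rw [Matrix.mul_neg, Matrix.neg_mul, h, diagonal_neg])
  have h3 := card_pos_add_card_neg (ne_zero_of_congruence hAu hV h)
  have h4 := numPosEigenvalues_add_neg hA hAu
  simp only [Left.neg_pos_iff] at h2
  omega

/-! ### The stable subspace of a symmetric pencil -/

/-- The sum of the eigenspaces of the pencil `lam A + H` for negative `lam`. For invertible `A`
this is the span of the eigenvectors of `-A⁻¹ H` with negative eigenvalue, and hence the stable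
subspace of `-A⁻¹ H` when `A` is symmetric and `H` is positive definite. -/
def pencilStable {ι : Type*} [Fintype ι] (A H : Matrix ι ι ℝ) : Submodule ℝ (ι → ℝ) :=
  Submodule.span ℝ {x | ∃ lam : ℝ, lam < 0 ∧ lam • (A *ᵥ x) + H *ᵥ x = 0}

section Pencil

variable {ι : Type*} [Fintype ι] [DecidableEq ι] {A H V : Matrix ι ι ℝ} {δ : ι → ℝ}

/-- The columns of `V` with positive `δ` form a basis of the stable subspace of the pencil. -/
theorem mem_pencilStable_iff (hH : Vᵀ * H * V = 1) (hA : Vᵀ * A * V = diagonal δ) (x : ι → ℝ) :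
    x ∈ pencilStable A H ↔ ∃ c : ι → ℝ, (∀ i, ¬ 0 < δ i → c i = 0) ∧ x = V *ᵥ c := by
  constructor
  · intro hx
    refine Submodule.span_induction ?_ ?_ ?_ ?_ hx
    · rintro x ⟨lam, hlam, hx⟩
      refine ⟨(Vᵀ * H) *ᵥ x, ?_, ?_⟩
      · intro i hi
        set c := (Vᵀ * H) *ᵥ x with hc
        have hxc : x = V *ᵥ c := by
          rw [hc, mulVec_mulVec, mul_congruence_eq_one hH, one_mulVec]
        have h1 : lam • ((Vᵀ * A * V) *ᵥ c) + (Vᵀ * H * V) *ᵥ c = 0 := by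
          rw [← mulVec_mulVec _ _ V, ← mulVec_mulVec _ _ V, ← hxc, ← mulVec_mulVec _ _ A,
            ← mulVec_mulVec _ _ H, ← mulVec_smul, ← mulVec_add, hx, mulVec_zero]
        rw [hA, hH, one_mulVec] at h1
        have h2 := congrFun h1 i
        simp only [Pi.add_apply, Pi.smul_apply, mulVec_diagonal, smul_eq_mul, Pi.zero_apply] at h2
        have h3 : c i * (1 + lam * δ i) = 0 := by linarith
        rcases mul_eq_zero.1 h3 with h4 | h4
        · exact h4
        · nlinarith
      · rw [mulVec_mulVec, mul_congruence_eq_one hH, one_mulVec]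
    · exact ⟨0, fun _ _ => rfl, by simp⟩
    · rintro x y _ _ ⟨c, hc, rfl⟩ ⟨d, hd, rfl⟩
      exact ⟨c + d, fun i hi => by simp [hc i hi, hd i hi], by rw [mulVec_add]⟩
    · rintro a x _ ⟨c, hc, rfl⟩
      exact ⟨a • c, fun i hi => by simp [hc i hi], by rw [mulVec_smul]⟩
  · rintro ⟨c, hc, rfl⟩
    have hsum : V *ᵥ c = ∑ i, c i • V.col i := by
      rw [mulVec_eq_sum]; simp [Matrix.col]
    rw [hsum]
    refine Submodule.sum_mem _ fun i _ => ?_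
    by_cases hi : 0 < δ i
    · refine Submodule.smul_mem _ _ (Submodule.subset_span ⟨-(δ i)⁻¹, by simpa using hi, ?_⟩)
      have h1 := congrArg (fun M : Matrix ι ι ℝ => M.col i) (mul_eq_of_congruence hH hA)
      have h2 : A *ᵥ V.col i = δ i • (H *ᵥ V.col i) := by
        funext j
        have := congrFun h1 j
        simp only [Matrix.col, transpose_apply, mul_diagonal] at this
        simp only [Pi.smul_apply, smul_eq_mul]
        rw [mul_comm]
        exact this
      rw [h2, smul_smul, neg_mul, inv_mul_cancel₀ hi.ne']
      simp
    · rw [hc i hi, zero_smul]; exact Submodule.zero_mem _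

theorem dotProduct_nonneg_of_mem_pencilStable (hA : A.IsSymm) (hH : H.PosDef) {x : ι → ℝ}
    (hx : x ∈ pencilStable A H) : 0 ≤ x ⬝ᵥ (A *ᵥ x) := by
  obtain ⟨V, δ, hV, hδ⟩ := exists_simultaneous_diagonalization hA hH
  obtain ⟨c, hc, rfl⟩ := (mem_pencilStable_iff hV hδ x).1 hx
  rw [dotProduct_mulVec_of_congruence hδ]
  refine Finset.sum_nonneg fun i _ => ?_
  by_cases hi : 0 < δ i
  · exact mul_nonneg hi.le (mul_self_nonneg _)
  · simp [hc i hi]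

/-- Every vector is the sum of a vector of the stable subspace and one that is orthogonal to it
for both forms and on which the form of `A` is nonpositive. -/
theorem exists_pencil_decomposition (hA : A.IsSymm) (hH : H.PosDef) (y : ι → ℝ) :
    ∃ z : ι → ℝ, y - z ∈ pencilStable A H ∧ z ⬝ᵥ (A *ᵥ y) = z ⬝ᵥ (A *ᵥ z) ∧
      z ⬝ᵥ (H *ᵥ y) = z ⬝ᵥ (H *ᵥ z) ∧ z ⬝ᵥ (A *ᵥ z) ≤ 0 := by
  obtain ⟨V, δ, hV, hδ⟩ := exists_simultaneous_diagonalization hA hH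
  set c := (Vᵀ * H) *ᵥ y with hc
  have hyc : y = V *ᵥ c := by rw [hc, mulVec_mulVec, mul_congruence_eq_one hV, one_mulVec]
  have hV' : Vᵀ * H * V = diagonal fun _ => 1 := by rw [hV, diagonal_one]
  set d : ι → ℝ := fun i => if 0 < δ i then 0 else c i with hd
  refine ⟨V *ᵥ d, ?_, ?_, ?_, ?_⟩
  · rw [mem_pencilStable_iff hV hδ]
    refine ⟨c - d, fun i hi => by simp [hd, hi], ?_⟩
    rw [mulVec_sub, ← hyc]
  · rw [hyc, dotProduct_mulVec_of_congruence hδ, dotProduct_mulVec_of_congruence hδ]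
    refine Finset.sum_congr rfl fun i _ => ?_
    by_cases hi : 0 < δ i <;> simp [hd, hi]
  · rw [hyc, dotProduct_mulVec_of_congruence hV', dotProduct_mulVec_of_congruence hV']
    refine Finset.sum_congr rfl fun i _ => ?_
    by_cases hi : 0 < δ i <;> simp [hd, hi]
  · rw [dotProduct_mulVec_of_congruence hδ]
    refine Finset.sum_nonpos fun i _ => ?_
    by_cases hi : 0 < δ i
    · simp [hd, hi]
    · exact mul_nonpos_of_nonpos_of_nonneg (not_lt.1 hi) (mul_self_nonneg _)

/-- The energy estimate: the unstable part `z` of an approximate eigenvector `y` of the pencil with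
negative eigenvalue is controlled by the residual. -/
theorem exists_pencilStable_near (hA : A.IsSymm) (hH : H.PosDef) {lam : ℝ} (hlam : lam < 0)
    (y : ι → ℝ) :
    ∃ z : ι → ℝ, y - z ∈ pencilStable A H ∧
      z ⬝ᵥ (H *ᵥ z) ≤ z ⬝ᵥ (lam • (A *ᵥ y) + H *ᵥ y) := by
  obtain ⟨z, h1, h2, h3, h4⟩ := exists_pencil_decomposition hA hH y
  refine ⟨z, h1, ?_⟩
  rw [dotProduct_add, dotProduct_smul, h2, h3, smul_eq_mul]
  nlinarith

end Pencil

/-! ### Positive definite forms -/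

theorem isSymm_of_posDef {κ : Type*} {H : Matrix κ κ ℝ} (hH : H.PosDef) : H.IsSymm := by
  have := hH.isHermitian
  rwa [Matrix.IsHermitian, conjTranspose_eq_transpose_of_trivial] at this

theorem posDef_of_isSymm {κ : Type*} [Fintype κ] {H : Matrix κ κ ℝ} (hH : H.IsSymm)
    (hpos : ∀ x : κ → ℝ, x ≠ 0 → 0 < x ⬝ᵥ (H *ᵥ x)) : H.PosDef := by
  refine .of_dotProduct_mulVec_pos ?_ fun x hx => by simpa using hpos x hx
  rwa [Matrix.IsHermitian, conjTranspose_eq_transpose_of_trivial]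

theorem dotProduct_mulVec_pos_of_posDef {κ : Type*} [Fintype κ] {H : Matrix κ κ ℝ}
    (hH : H.PosDef) {x : κ → ℝ} (hx : x ≠ 0) : 0 < x ⬝ᵥ (H *ᵥ x) := by
  simpa using hH.dotProduct_mulVec_pos hx

theorem two_mul_dotProduct_le {ι : Type*} [Fintype ι] (a b : ι → ℝ) {t : ℝ} (ht : 0 < t) :
    2 * (a ⬝ᵥ b) ≤ t * (a ⬝ᵥ a) + t⁻¹ * (b ⬝ᵥ b) := by
  have h : 0 ≤ (t • a - b) ⬝ᵥ (t • a - b) := Finset.sum_nonneg fun i _ => mul_self_nonneg _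
  rw [sub_dotProduct, dotProduct_sub, dotProduct_sub, smul_dotProduct, dotProduct_smul,
    dotProduct_smul, smul_dotProduct, dotProduct_comm b a] at h
  simp only [smul_eq_mul] at h
  have h2 : t * (a ⬝ᵥ a) + t⁻¹ * (b ⬝ᵥ b) - 2 * (a ⬝ᵥ b) =
      t⁻¹ * (t * (t * (a ⬝ᵥ a)) - t * (a ⬝ᵥ b) - (t * (a ⬝ᵥ b) - b ⬝ᵥ b)) := by
    field_simp; ring
  have h3 : 0 ≤ t⁻¹ * (t * (t * (a ⬝ᵥ a)) - t * (a ⬝ᵥ b) - (t * (a ⬝ᵥ b) - b ⬝ᵥ b)) :=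
    mul_nonneg (inv_nonneg.2 ht.le) h
  linarith

/-! ### Limits of stable vectors as the Laplace variable tends to zero -/

section Limit

variable {ι κ : Type*} [Fintype ι] [DecidableEq ι] [Fintype κ] [DecidableEq κ]

/-- `ξ I - Q` with `ξ = τ ^ 2` and `Q = diag(0, S)`. The square root of `ξ` is used as the
parameter because it is the size of the eigenvalues belonging to the kernel of `A₁₁`. -/
def dampingMatrix (ι : Type*) [DecidableEq ι] (S : Matrix κ κ ℝ) (τ : ℝ) :
    Matrix (ι ⊕ κ) (ι ⊕ κ) ℝ :=
  fromBlocks (τ ^ 2 • 1) 0 0 (τ ^ 2 • 1 - S)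

theorem dampingMatrix_mulVec (S : Matrix κ κ ℝ) (τ : ℝ) (u : ι → ℝ) (v : κ → ℝ) :
    dampingMatrix ι S τ *ᵥ Sum.elim u v = Sum.elim (τ ^ 2 • u) (τ ^ 2 • v - S *ᵥ v) := by
  simp [dampingMatrix, fromBlocks_mulVec, sub_mulVec, smul_mulVec]

/-- A positive definite form dominates a multiple of the Euclidean one. -/
theorem exists_pos_mul_dotProduct_self_le {H : Matrix κ κ ℝ} (hH : H.PosDef) :
    ∃ c : ℝ, 0 < c ∧ ∀ x : κ → ℝ, c * (x ⬝ᵥ x) ≤ x ⬝ᵥ (H *ᵥ x) := by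
  obtain ⟨U, e, hU, he⟩ := exists_orthogonal_diagonalization (isSymm_of_posDef hH)
  have hUU : U * Uᵀ = 1 := mul_eq_one_comm.1 hU
  have hU1 : Uᵀ * (1 : Matrix κ κ ℝ) * U = diagonal fun _ => 1 := by
    rw [Matrix.mul_one, hU, diagonal_one]
  have hpos : ∀ i, 0 < e i := by
    intro i
    have hx : U *ᵥ Pi.single i 1 ≠ 0 := by
      intro h
      have h2 : Uᵀ *ᵥ (U *ᵥ Pi.single i 1) = 0 := by rw [h, mulVec_zero]
      rw [mulVec_mulVec, hU, one_mulVec] at h2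
      simpa using congrFun h2 i
    have := dotProduct_mulVec_pos_of_posDef hH hx
    rw [dotProduct_mulVec_of_congruence he] at this
    simpa [Pi.single_apply] using this
  obtain ⟨c, hc, hce⟩ : ∃ c : ℝ, 0 < c ∧ ∀ i, c ≤ e i := by
    rcases isEmpty_or_nonempty κ with h | h
    · exact ⟨1, one_pos, fun i => (h.false i).elim⟩
    · obtain ⟨i, hi⟩ := Finite.exists_min e
      exact ⟨e i, hpos i, hi⟩
  refine ⟨c, hc, fun x => ?_⟩
  have hx : x = U *ᵥ (Uᵀ *ᵥ x) := by rw [mulVec_mulVec, hUU, one_mulVec]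
  have h1 : x ⬝ᵥ x = x ⬝ᵥ ((1 : Matrix κ κ ℝ) *ᵥ x) := by rw [one_mulVec]
  rw [h1, hx, dotProduct_mulVec_of_congruence he, dotProduct_mulVec_of_congruence hU1,
    Finset.mul_sum]
  refine Finset.sum_le_sum fun i _ => ?_
  rw [one_mul]
  exact mul_le_mul_of_nonneg_right (hce i) (mul_self_nonneg _)

theorem posDef_dampingMatrix {S : Matrix κ κ ℝ} (hS : (-S).PosDef) {τ : ℝ} (hτ : 0 < τ) :
    (dampingMatrix ι S τ).PosDef := by
  have hSs : S.IsSymm := by simpa using (isSymm_of_posDef hS).neg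
  have hform : ∀ v : κ → ℝ, 0 ≤ -(v ⬝ᵥ (S *ᵥ v)) := fun v => by
    have := hS.posSemidef.dotProduct_mulVec_nonneg v
    simpa [neg_mulVec] using this
  refine posDef_of_isSymm ?_ fun x hx => ?_
  · simp [Matrix.IsSymm, dampingMatrix, fromBlocks_transpose, hSs.eq]
  · obtain ⟨u, v, rfl⟩ : ∃ u v, x = Sum.elim u v := ⟨x ∘ Sum.inl, x ∘ Sum.inr, by simp⟩
    have h0 : 0 < Sum.elim u v ⬝ᵥ Sum.elim u v :=
      lt_of_le_of_ne (Finset.sum_nonneg fun i _ => mul_self_nonneg _)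
        fun h => hx (dotProduct_self_eq_zero.1 h.symm)
    rw [sumElim_dotProduct_sumElim] at h0
    rw [dampingMatrix_mulVec, sumElim_dotProduct_sumElim, dotProduct_smul, dotProduct_sub,
      dotProduct_smul, smul_eq_mul, smul_eq_mul]
    have := hform v
    have h3 : 0 < τ ^ 2 := by positivity
    nlinarith

/-- The limits, as `τ` tends to zero from the right, of vectors in the stable subspaces of the
pencils `lam A + (τ ^ 2 I - Q)`. -/
def limitStable (A : Matrix (ι ⊕ κ) (ι ⊕ κ) ℝ) (S : Matrix κ κ ℝ) :
    Submodule ℝ (ι ⊕ κ → ℝ) where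
  carrier := {x | ∃ y : ℝ → ι ⊕ κ → ℝ, Tendsto y (𝓝[>] 0) (𝓝 x) ∧
    ∀ τ, 0 < τ → y τ ∈ pencilStable A (dampingMatrix ι S τ)}
  zero_mem' := ⟨fun _ => 0, tendsto_const_nhds, fun _ _ => Submodule.zero_mem _⟩
  add_mem' := by
    rintro a b ⟨y, hy, hy'⟩ ⟨z, hz, hz'⟩
    exact ⟨fun τ => y τ + z τ, hy.add hz, fun τ hτ => Submodule.add_mem _ (hy' τ hτ) (hz' τ hτ)⟩
  smul_mem' := by
    rintro c a ⟨y, hy, hy'⟩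
    exact ⟨fun τ => c • y τ, hy.const_smul c, fun τ hτ => Submodule.smul_mem _ _ (hy' τ hτ)⟩

theorem dotProduct_nonneg_of_mem_limitStable {A : Matrix (ι ⊕ κ) (ι ⊕ κ) ℝ} {S : Matrix κ κ ℝ}
    (hA : A.IsSymm) (hS : (-S).PosDef) {x : ι ⊕ κ → ℝ} (hx : x ∈ limitStable A S) :
    0 ≤ x ⬝ᵥ (A *ᵥ x) := by
  obtain ⟨y, hy, hy'⟩ := hx
  have hc : Continuous fun x : ι ⊕ κ → ℝ => x ⬝ᵥ (A *ᵥ x) := by fun_prop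
  refine ge_of_tendsto ((hc.tendsto x).comp hy) ?_
  filter_upwards [self_mem_nhdsWithin] with τ hτ
  exact dotProduct_nonneg_of_mem_pencilStable hA (posDef_dampingMatrix hS hτ) (hy' τ hτ)

theorem finrank_limitStable_le {A : Matrix (ι ⊕ κ) (ι ⊕ κ) ℝ} {S : Matrix κ κ ℝ}
    (hA : A.IsSymm) (hAu : IsUnit A) (hS : (-S).PosDef) :
    Module.finrank ℝ (limitStable A S) ≤ numPosEigenvalues A :=
  finrank_le_numPosEigenvalues hA hAu (limitStable A S).subtype Subtype.val_injective
    fun x => dotProduct_nonneg_of_mem_limitStable hA hS x.2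

theorem tendsto_zero_of_dotProduct_self {ι : Type*} [Fintype ι] {l : Filter ℝ} {z : ℝ → ι → ℝ}
    (h : Tendsto (fun τ => z τ ⬝ᵥ z τ) l (𝓝 0)) : Tendsto z l (𝓝 0) := by
  rw [tendsto_pi_nhds]
  intro i
  have h1 : Tendsto (fun τ => Real.sqrt (z τ ⬝ᵥ z τ)) l (𝓝 0) :=
    (Real.continuous_sqrt.tendsto' 0 0 Real.sqrt_zero).comp h
  refine squeeze_zero_norm (fun τ => ?_) h1
  refine Real.le_sqrt_of_sq_le ?_
  rw [Real.norm_eq_abs, sq_abs, sq]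
  exact Finset.single_le_sum (f := fun j => z τ j * z τ j) (fun j _ => mul_self_nonneg _)
    (Finset.mem_univ i)

/-- If the residual of the approximate eigenvectors `y τ` is `o(τ ^ 2)` in the conserved and `o(τ)`
in the relaxing components, then by the energy estimate the unstable parts tend to zero. -/
theorem mem_limitStable_of_residual {A : Matrix (ι ⊕ κ) (ι ⊕ κ) ℝ} {S : Matrix κ κ ℝ}
    (hA : A.IsSymm) (hS : (-S).PosDef) {lam : ℝ → ℝ} (hlam : ∀ τ, 0 < τ → lam τ < 0)
    {y : ℝ → ι ⊕ κ → ℝ} {x : ι ⊕ κ → ℝ} (hy : Tendsto y (𝓝[>] 0) (𝓝 x))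
    {f : ℝ → ι → ℝ} {g : ℝ → κ → ℝ} (hf : Tendsto f (𝓝[>] 0) (𝓝 0))
    (hg : Tendsto g (𝓝[>] 0) (𝓝 0))
    (hres : ∀ τ, 0 < τ → lam τ • (A *ᵥ y τ) + dampingMatrix ι S τ *ᵥ y τ =
      Sum.elim (τ ^ 2 • f τ) (τ • g τ)) :
    x ∈ limitStable A S := by
  have hex : ∀ τ, ∃ z : ι ⊕ κ → ℝ, 0 < τ → y τ - z ∈ pencilStable A (dampingMatrix ι S τ) ∧
      z ⬝ᵥ (dampingMatrix ι S τ *ᵥ z) ≤ z ⬝ᵥ Sum.elim (τ ^ 2 • f τ) (τ • g τ) := by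
    intro τ
    by_cases hτ : 0 < τ
    · obtain ⟨z, h1, h2⟩ :=
        exists_pencilStable_near hA (posDef_dampingMatrix hS hτ) (hlam τ hτ) (y τ)
      exact ⟨z, fun _ => ⟨h1, by rwa [hres τ hτ] at h2⟩⟩
    · exact ⟨0, fun h => (hτ h).elim⟩
  choose z hz using hex
  obtain ⟨c, hc, hcS⟩ := exists_pos_mul_dotProduct_self_le hS
  set u : ℝ → ι → ℝ := fun τ => z τ ∘ Sum.inl with hu
  set v : ℝ → κ → ℝ := fun τ => z τ ∘ Sum.inr with hv
  have hzuv : ∀ τ, z τ = Sum.elim (u τ) (v τ) := fun τ => by simp [hu, hv]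
  have key : ∀ τ, 0 < τ → τ ^ 2 * (u τ ⬝ᵥ u τ) + c * (v τ ⬝ᵥ v τ) ≤
      τ ^ 2 * (f τ ⬝ᵥ f τ + c⁻¹ * (g τ ⬝ᵥ g τ)) := by
    intro τ hτ
    have h1 := (hz τ hτ).2
    rw [hzuv τ, dampingMatrix_mulVec, sumElim_dotProduct_sumElim, sumElim_dotProduct_sumElim,
      dotProduct_smul, dotProduct_sub, dotProduct_smul, dotProduct_smul,
      dotProduct_smul τ] at h1
    simp only [smul_eq_mul] at h1
    have h2 := hcS (v τ)
    rw [neg_mulVec, dotProduct_neg] at h2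
    have h3 := two_mul_dotProduct_le (u τ) (f τ) one_pos
    have h4 := two_mul_dotProduct_le (v τ) (τ • g τ) hc
    have h5 : 0 ≤ v τ ⬝ᵥ v τ := Finset.sum_nonneg fun i _ => mul_self_nonneg _
    have h6 : (τ • g τ) ⬝ᵥ (τ • g τ) = τ ^ 2 * (g τ ⬝ᵥ g τ) := by
      simp only [smul_dotProduct, dotProduct_smul, smul_eq_mul]; ring
    rw [h6] at h4
    rw [inv_one, one_mul, one_mul] at h3
    have h7 := mul_le_mul_of_nonneg_left h3 (sq_nonneg τ)
    have h8 := mul_nonneg (sq_nonneg τ) h5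
    have h9 : c⁻¹ * (τ ^ 2 * (g τ ⬝ᵥ g τ)) = τ ^ 2 * (c⁻¹ * (g τ ⬝ᵥ g τ)) := by ring
    rw [dotProduct_smul, smul_eq_mul] at h4
    rw [mul_add]
    linarith
  have hbound : Tendsto (fun τ => f τ ⬝ᵥ f τ + c⁻¹ * (g τ ⬝ᵥ g τ)) (𝓝[>] 0) (𝓝 0) := by
    have h1 : Continuous fun x : ι → ℝ => x ⬝ᵥ x := by fun_prop
    have h2 : Continuous fun x : κ → ℝ => x ⬝ᵥ x := by fun_prop
    simpa using ((h1.tendsto 0).comp hf).add (((h2.tendsto 0).comp hg).const_mul c⁻¹)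
  have hτ0 : Tendsto (fun τ : ℝ => τ ^ 2) (𝓝[>] 0) (𝓝 0) := by
    have : Continuous fun τ : ℝ => τ ^ 2 := by fun_prop
    simpa using (this.tendsto 0).mono_left nhdsWithin_le_nhds
  have hu0 : Tendsto u (𝓝[>] 0) (𝓝 0) := by
    refine tendsto_zero_of_dotProduct_self (squeeze_zero' (Eventually.of_forall fun τ =>
      Finset.sum_nonneg fun i _ => mul_self_nonneg _) ?_ hbound)
    filter_upwards [self_mem_nhdsWithin] with τ hτ
    have h5 : 0 ≤ v τ ⬝ᵥ v τ := Finset.sum_nonneg fun i _ => mul_self_nonneg _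
    have h6 : (0 : ℝ) < τ ^ 2 := pow_pos hτ 2
    have h7 := mul_nonneg hc.le h5
    exact le_of_mul_le_mul_left (by linarith [key τ hτ]) h6
  have hv0 : Tendsto v (𝓝[>] 0) (𝓝 0) := by
    have hb := (hτ0.mul hbound).const_mul c⁻¹
    simp only [mul_zero] at hb
    refine tendsto_zero_of_dotProduct_self (squeeze_zero' (Eventually.of_forall fun τ =>
      Finset.sum_nonneg fun i _ => mul_self_nonneg _) ?_ hb)
    filter_upwards [self_mem_nhdsWithin] with τ hτ
    have h5 : 0 ≤ u τ ⬝ᵥ u τ := Finset.sum_nonneg fun i _ => mul_self_nonneg _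
    have h7 := mul_nonneg (sq_nonneg τ) h5
    rw [← mul_le_mul_iff_right₀ hc, mul_inv_cancel_left₀ hc.ne']
    linarith [key τ hτ]
  have hz0 : Tendsto z (𝓝[>] 0) (𝓝 0) := by
    rw [tendsto_pi_nhds] at hu0 hv0 ⊢
    rintro (i | i)
    · exact hu0 i
    · exact hv0 i
  exact ⟨fun τ => y τ - z τ, by simpa using hy.sub hz0, fun τ hτ => (hz τ hτ).1⟩

end Limit

/-! ### Vectors in the limit of the stable subspaces -/

theorem fromBlocks_mulVec_sumElim {ι κ : Type*} [Fintype ι] [Fintype κ] (A11 : Matrix ι ι ℝ)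
    (A12 : Matrix ι κ ℝ) (A12' : Matrix κ ι ℝ) (A22 : Matrix κ κ ℝ) (u : ι → ℝ) (v : κ → ℝ) :
    fromBlocks A11 A12 A12' A22 *ᵥ Sum.elim u v =
      Sum.elim (A11 *ᵥ u + A12 *ᵥ v) (A12' *ᵥ u + A22 *ᵥ v) := by
  simp [fromBlocks_mulVec]

theorem sumElim_add_sumElim {ι κ : Type*} (u u' : ι → ℝ) (v v' : κ → ℝ) :
    Sum.elim u v + Sum.elim u' v' = Sum.elim (u + u') (v + v') := by
  funext i; cases i <;> rfl

theorem smul_sumElim {ι κ : Type*} (c : ℝ) (u : ι → ℝ) (v : κ → ℝ) :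
    c • Sum.elim u v = Sum.elim (c • u) (c • v) := by
  funext i; cases i <;> rfl

theorem tendsto_sumElim {ι κ : Type*} {u : ℝ → ι → ℝ} {v : ℝ → κ → ℝ} {l : Filter ℝ}
    {a : ι → ℝ} {b : κ → ℝ}
    (hu : Tendsto u l (𝓝 a)) (hv : Tendsto v l (𝓝 b)) :
    Tendsto (fun τ => Sum.elim (u τ) (v τ)) l (𝓝 (Sum.elim a b)) := by
  rw [tendsto_pi_nhds] at hu hv ⊢
  rintro (i | i)
  · exact hu i
  · exact hv i

theorem tendsto_nhdsGT_zero {E : Type*} [TopologicalSpace E] {F : ℝ → E} {a : E}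
    (hF : Continuous F) (h : F 0 = a) : Tendsto F (𝓝[>] 0) (𝓝 a) :=
  (hF.tendsto' 0 a h).mono_left nhdsWithin_le_nhds

section Members

variable {ι κ : Type*} [Fintype ι] [DecidableEq ι] [Fintype κ] [DecidableEq κ]
  {A11 : Matrix ι ι ℝ} {A12 : Matrix ι κ ℝ} {A22 S : Matrix κ κ ℝ}

/-- An eigenvector of `A₁₁` with positive eigenvalue `a` is an approximate eigenvector of the pencil
with eigenvalue `-τ ^ 2 / a`. -/
theorem mem_limitStable_of_eigenvector (hA : (fromBlocks A11 A12 A12ᵀ A22).IsSymm)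
    (hS : (-S).PosDef) {a : ℝ} (ha : 0 < a) {u : ι → ℝ} (hu : A11 *ᵥ u = a • u) :
    Sum.elim u 0 ∈ limitStable (fromBlocks A11 A12 A12ᵀ A22) S := by
  refine mem_limitStable_of_residual hA hS (lam := fun τ => -(τ ^ 2 * a⁻¹)) (y := fun _ =>
    Sum.elim u 0) (f := fun _ => 0) (g := fun τ => -(τ * a⁻¹) • (A12ᵀ *ᵥ u))
    (fun τ hτ => by simpa using by positivity) tendsto_const_nhds tendsto_const_nhds
    (tendsto_nhdsGT_zero (by fun_prop) (by simp)) fun τ hτ => ?_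
  rw [fromBlocks_mulVec_sumElim, dampingMatrix_mulVec, smul_sumElim, sumElim_add_sumElim, hu]
  congr 1
  · rw [mulVec_zero, add_zero, smul_smul, smul_zero, neg_mul, inv_mul_cancel_right₀ ha.ne']
    module
  · rw [mulVec_zero, mulVec_zero]
    module

/-- A kernel vector of `A₁₁` corrected at order `τ` is an approximate eigenvector of the pencil with
eigenvalue `lam * τ`: this is the layer of thickness `√ε`. -/
theorem mem_limitStable_of_kernel (hA : (fromBlocks A11 A12 A12ᵀ A22).IsSymm)
    (hS : (-S).PosDef) {lam : ℝ} (hlam : lam < 0) {u u1 : ι → ℝ} {v1 : κ → ℝ}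
    (hu : A11 *ᵥ u = 0) (hv1 : S *ᵥ v1 = lam • (A12ᵀ *ᵥ u))
    (hu1 : lam • (A11 *ᵥ u1 + A12 *ᵥ v1) + u = 0) :
    Sum.elim u 0 ∈ limitStable (fromBlocks A11 A12 A12ᵀ A22) S := by
  refine mem_limitStable_of_residual hA hS (lam := fun τ => τ * lam) (y := fun τ =>
    Sum.elim (u + τ • u1) (τ • v1)) (f := fun τ => τ • u1)
    (g := fun τ => τ • (lam • (A12ᵀ *ᵥ u1 + A22 *ᵥ v1) + τ • v1))
    (fun τ hτ => mul_neg_of_pos_of_neg hτ hlam)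
    (tendsto_sumElim (tendsto_nhdsGT_zero (by fun_prop) (by simp))
      (tendsto_nhdsGT_zero (by fun_prop) (by simp)))
    (tendsto_nhdsGT_zero (by fun_prop) (by simp))
    (tendsto_nhdsGT_zero (by fun_prop) (by simp)) fun τ hτ => ?_
  rw [fromBlocks_mulVec_sumElim, dampingMatrix_mulVec, smul_sumElim, sumElim_add_sumElim]
  simp only [mulVec_add, mulVec_smul, hu, hv1]
  congr 1
  · linear_combination (norm := module) (τ ^ 2) • hu1
  · module

/-- Stable eigenvectors of the pencil `lam A - Q` persist: this is the layer of thickness `ε`. The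
correction of order `τ ^ 2` makes the residual small in the undamped components. -/
theorem mem_limitStable_of_layer (hA : (fromBlocks A11 A12 A12ᵀ A22).IsSymm)
    (hAu : IsUnit (fromBlocks A11 A12 A12ᵀ A22))
    (hS : (-S).PosDef) {lam : ℝ} (hlam : lam < 0) {u : ι → ℝ} {v : κ → ℝ}
    (h1 : A11 *ᵥ u + A12 *ᵥ v = 0) (h2 : lam • (A12ᵀ *ᵥ u + A22 *ᵥ v) = S *ᵥ v) :
    Sum.elim u v ∈ limitStable (fromBlocks A11 A12 A12ᵀ A22) S := by
  obtain ⟨u1, v1, h3⟩ : ∃ (u1 : ι → ℝ) (v1 : κ → ℝ), A11 *ᵥ u1 + A12 *ᵥ v1 = -lam⁻¹ • u := by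
    obtain ⟨T, hT⟩ := hAu.exists_right_inv
    set x := T *ᵥ Sum.elim (-lam⁻¹ • u) (0 : κ → ℝ) with hx
    refine ⟨x ∘ Sum.inl, x ∘ Sum.inr, ?_⟩
    have h4 := fromBlocks_mulVec_sumElim A11 A12 A12ᵀ A22
      (x ∘ Sum.inl) (x ∘ Sum.inr)
    rw [Sum.elim_comp_inl_inr, hx, mulVec_mulVec, hT, one_mulVec] at h4
    funext i
    exact (congrFun h4 (Sum.inl i)).symm
  have h3' : lam • (A11 *ᵥ u1 + A12 *ᵥ v1) + u = 0 := by
    rw [h3, smul_smul, mul_neg, mul_inv_cancel₀ hlam.ne]; module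
  refine mem_limitStable_of_residual hA hS (lam := fun _ => lam) (y := fun τ =>
    Sum.elim (u + τ ^ 2 • u1) (v + τ ^ 2 • v1)) (f := fun τ => τ ^ 2 • u1)
    (g := fun τ => τ • (lam • (A12ᵀ *ᵥ u1 + A22 *ᵥ v1) + v - S *ᵥ v1 + τ ^ 2 • v1))
    (fun τ hτ => hlam)
    (tendsto_sumElim (tendsto_nhdsGT_zero (by fun_prop) (by simp))
      (tendsto_nhdsGT_zero (by fun_prop) (by simp)))
    (tendsto_nhdsGT_zero (by fun_prop) (by simp))
    (tendsto_nhdsGT_zero (by fun_prop) (by simp)) fun τ hτ => ?_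
  rw [fromBlocks_mulVec_sumElim, dampingMatrix_mulVec, smul_sumElim, sumElim_add_sumElim]
  simp only [mulVec_add, mulVec_smul]
  congr 1
  · linear_combination (norm := module) (τ ^ 2) • h3' + lam • h1
  · linear_combination (norm := module) h2

end Members

/-! ### The boundary layer at a characteristic boundary -/

theorem isUnit_of_mulVec_eq_zero {ι : Type*} [Fintype ι] [DecidableEq ι] {M : Matrix ι ι ℝ}
    (h : ∀ x, M *ᵥ x = 0 → x = 0) : IsUnit M := by
  rw [← mulVec_injective_iff_isUnit]
  exact (injective_iff_map_eq_zero M.mulVecLin).2 h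

/-- The standing assumptions on the coefficient matrices: `A₁` is invertible, `(P₁, P₀)`
diagonalizes `A₁₁`, and the columns of `K̃` span the orthogonal complement of those of `K`. -/
structure IsLayerFrame {m r p n1o s : ℕ} (A1 : Matrix (Fin m ⊕ Fin r) (Fin m ⊕ Fin r) ℝ)
    (S : Matrix (Fin r) (Fin r) ℝ) (P1 : Matrix (Fin m) (Fin p) ℝ)
    (P0 : Matrix (Fin m) (Fin n1o) ℝ) (Λ1 : Fin p → ℝ) (Kt : Matrix (Fin r) (Fin s) ℝ) :
    Prop where
  isSymm : A1.IsSymm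
  isUnit : IsUnit A1
  posDef : (-S).PosDef
  splitting : IsEigenSplitting A1.toBlocks₁₁ P1 P0 Λ1
  invertible : IsInvertibleMatrix (fromCols (matK A1 P0) Kt)
  orthogonal : Ktᵀ * matK A1 P0 = 0

namespace IsLayerFrame

variable {m r p n1o s : ℕ} {A1 : Matrix (Fin m ⊕ Fin r) (Fin m ⊕ Fin r) ℝ}
  {S : Matrix (Fin r) (Fin r) ℝ} {P1 : Matrix (Fin m) (Fin p) ℝ}
  {P0 : Matrix (Fin m) (Fin n1o) ℝ} {Λ1 : Fin p → ℝ} {Kt : Matrix (Fin r) (Fin s) ℝ}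

theorem eq_fromBlocks (h : IsLayerFrame A1 S P1 P0 Λ1 Kt) :
    A1 = fromBlocks A1.toBlocks₁₁ A1.toBlocks₁₂ A1.toBlocks₁₂ᵀ A1.toBlocks₂₂ := by
  conv_lhs => rw [← fromBlocks_toBlocks A1]
  congr 1
  ext i j
  exact h.isSymm.apply _ _

theorem mul_P1_and_P0 (h : IsLayerFrame A1 S P1 P0 Λ1 Kt) :
    A1.toBlocks₁₁ * P1 = P1 * diagonal Λ1 ∧ A1.toBlocks₁₁ * P0 = 0 := by
  obtain ⟨-, h2, h3, -⟩ := h.splitting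
  have h4 : A1.toBlocks₁₁ * fromCols P1 P0 =
      fromCols P1 P0 * (fromBlocks (diagonal Λ1) 0 0 0 :
        Matrix (Fin p ⊕ Fin n1o) (Fin p ⊕ Fin n1o) ℝ) := by
    rw [← h3, ← Matrix.mul_assoc, ← Matrix.mul_assoc, h2, Matrix.one_mul]
  rw [← fromRows_fromCols_eq_fromBlocks, fromCols_mul_fromRows, mul_fromCols, mul_fromCols,
    mul_fromCols] at h4
  simp only [Matrix.mul_zero, fromCols_zero, add_zero] at h4
  exact fromCols_inj h4

theorem transpose_mul_P (h : IsLayerFrame A1 S P1 P0 Λ1 Kt) :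
    P1ᵀ * P1 = 1 ∧ P1ᵀ * P0 = 0 ∧ P0ᵀ * P1 = 0 ∧ P0ᵀ * P0 = 1 := by
  have h1 := h.splitting.1
  rw [transpose_fromCols, fromRows_mul_fromCols, ← fromBlocks_one, fromBlocks_inj] at h1
  exact h1

theorem P1_add_P0 (h : IsLayerFrame A1 S P1 P0 Λ1 Kt) : P1 * P1ᵀ + P0 * P0ᵀ = 1 := by
  have h1 := h.splitting.2.1
  rwa [transpose_fromCols, fromCols_mul_fromRows] at h1

theorem diagonal_mul_inv (h : IsLayerFrame A1 S P1 P0 Λ1 Kt) :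
    diagonal Λ1 * (diagonal Λ1)⁻¹ = 1 := by
  refine mul_nonsing_inv _ ?_
  rw [det_diagonal]
  exact (Finset.prod_ne_zero_iff.2 fun i _ => h.splitting.2.2.2 i).isUnit

/-- `P₁ Λ₁⁻¹ P₁ᵀ` is the pseudoinverse of `A₁₁`. -/
theorem mul_pseudoinverse (h : IsLayerFrame A1 S P1 P0 Λ1 Kt) :
    A1.toBlocks₁₁ * (P1 * (diagonal Λ1)⁻¹ * P1ᵀ) = 1 - P0 * P0ᵀ := by
  rw [← Matrix.mul_assoc, ← Matrix.mul_assoc, h.mul_P1_and_P0.1, Matrix.mul_assoc P1,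
    h.diagonal_mul_inv, Matrix.mul_one, ← h.P1_add_P0, add_sub_cancel_right]

theorem transpose_matK_mul (h : IsLayerFrame A1 S P1 P0 Λ1 Kt) : (matK A1 P0)ᵀ * Kt = 0 := by
  rw [← transpose_transpose ((matK A1 P0)ᵀ * Kt), transpose_mul, transpose_transpose,
    h.orthogonal, transpose_zero]

theorem matK_injective (h : IsLayerFrame A1 S P1 P0 Λ1 Kt) (x : Fin n1o → ℝ)
    (hx : matK A1 P0 *ᵥ x = 0) : x = 0 := by
  obtain ⟨X, -, hX⟩ := h.invertible
  have h1 : Sum.elim x (0 : Fin s → ℝ) = (0 : Fin n1o ⊕ Fin s → ℝ) := by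
    rw [← one_mulVec (Sum.elim x (0 : Fin s → ℝ)), ← hX, ← mulVec_mulVec,
      fromCols_mulVec_sumElim, hx]
    simp
  funext i
  exact congrFun h1 (Sum.inl i)

theorem Kt_injective (h : IsLayerFrame A1 S P1 P0 Λ1 Kt) (x : Fin s → ℝ)
    (hx : Kt *ᵥ x = 0) : x = 0 := by
  obtain ⟨X, -, hX⟩ := h.invertible
  have h1 : Sum.elim (0 : Fin n1o → ℝ) x = (0 : Fin n1o ⊕ Fin s → ℝ) := by
    rw [← one_mulVec (Sum.elim (0 : Fin n1o → ℝ) x), ← hX, ← mulVec_mulVec,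
      fromCols_mulVec_sumElim, hx]
    simp
  funext i
  exact congrFun h1 (Sum.inr i)

/-- A vector orthogonal to the columns of `K` and of `K̃` vanishes. -/
theorem eq_zero_of_transpose_mulVec (h : IsLayerFrame A1 S P1 P0 Λ1 Kt) (x : Fin r → ℝ)
    (h1 : (matK A1 P0)ᵀ *ᵥ x = 0) (h2 : Ktᵀ *ᵥ x = 0) : x = 0 := by
  obtain ⟨X, hX, -⟩ := h.invertible
  have h3 : Xᵀ * (fromCols (matK A1 P0) Kt)ᵀ = 1 := by
    rw [← transpose_mul, hX, transpose_one]
  rw [← one_mulVec x, ← h3, ← mulVec_mulVec, transpose_fromCols, fromRows_mulVec, h1, h2]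
  simp

theorem card_eq (h : IsLayerFrame A1 S P1 P0 Λ1 Kt) : n1o + s = r ∧ p + n1o = m := by
  constructor
  · obtain ⟨X, hX, hX'⟩ := h.invertible
    simpa using (square_of_invertible _ _ hX hX').symm
  · simpa using (square_of_invertible _ _ h.splitting.2.1 h.splitting.1).symm

theorem posDef_gram_Kt (h : IsLayerFrame A1 S P1 P0 Λ1 Kt) : (-(Ktᵀ * S * Kt)).PosDef := by
  have h1 := h.posDef.conjTranspose_mul_mul_same (B := Kt)
    ((injective_iff_map_eq_zero Kt.mulVecLin).2 h.Kt_injective)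
  rwa [conjTranspose_eq_transpose_of_trivial, Matrix.mul_neg, Matrix.neg_mul] at h1

theorem isUnit_gram_Kt (h : IsLayerFrame A1 S P1 P0 Λ1 Kt) : IsUnit (Ktᵀ * S * Kt) := by
  simpa using h.posDef_gram_Kt.isUnit.neg

theorem isUnit_gram_matK (h : IsLayerFrame A1 S P1 P0 Λ1 Kt) :
    IsUnit ((matK A1 P0)ᵀ * matK A1 P0) := by
  refine isUnit_of_mulVec_eq_zero fun x hx => h.matK_injective x ?_
  rw [← dotProduct_self_eq_zero, ← vecMul_transpose, ← dotProduct_mulVec, vecMul_transpose,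
    mulVec_mulVec, hx, dotProduct_zero]

theorem isSymm_matA (h : IsLayerFrame A1 S P1 P0 Λ1 Kt) : (matA A1 P1 Λ1).IsSymm := by
  have h1 : A1.toBlocks₂₂ᵀ = A1.toBlocks₂₂ := by
    ext i j; exact h.isSymm.apply _ _
  have h2 : ((diagonal Λ1)⁻¹)ᵀ = (diagonal Λ1)⁻¹ := by
    rw [transpose_nonsing_inv, diagonal_transpose]
  rw [Matrix.IsSymm, matA, transpose_sub, h1]
  simp only [transpose_mul, transpose_transpose, h2, Matrix.mul_assoc]

/-- `A₁` applied to a vector whose relaxing component is `v = K̃ w` and whose conserved component is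
the solution of `A₁₁ u + A₁₂ v = 0` with kernel part `P₀ μ`. -/
theorem mulVec_layer (h : IsLayerFrame A1 S P1 P0 Λ1 Kt) (w : Fin s → ℝ) (μ : Fin n1o → ℝ) :
    A1.toBlocks₁₁ *ᵥ (-(P1 * (diagonal Λ1)⁻¹ * P1ᵀ * A1.toBlocks₁₂ * Kt) *ᵥ w + P0 *ᵥ μ) +
        A1.toBlocks₁₂ *ᵥ (Kt *ᵥ w) = 0 ∧
      A1.toBlocks₁₂ᵀ *ᵥ (-(P1 * (diagonal Λ1)⁻¹ * P1ᵀ * A1.toBlocks₁₂ * Kt) *ᵥ w + P0 *ᵥ μ) +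
        A1.toBlocks₂₂ *ᵥ (Kt *ᵥ w) = (matA A1 P1 Λ1 * Kt) *ᵥ w + matK A1 P0 *ᵥ μ := by
  constructor
  · have h1 : A1.toBlocks₁₁ * (P1 * (diagonal Λ1)⁻¹ * P1ᵀ * A1.toBlocks₁₂ * Kt) =
        A1.toBlocks₁₂ * Kt := by
      have h2 : P0ᵀ * A1.toBlocks₁₂ * Kt = 0 := by
        rw [← h.transpose_matK_mul, matK, transpose_mul, transpose_transpose]
      calc A1.toBlocks₁₁ * (P1 * (diagonal Λ1)⁻¹ * P1ᵀ * A1.toBlocks₁₂ * Kt)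
          = A1.toBlocks₁₁ * (P1 * (diagonal Λ1)⁻¹ * P1ᵀ) * (A1.toBlocks₁₂ * Kt) := by
            simp only [Matrix.mul_assoc]
        _ = A1.toBlocks₁₂ * Kt - P0 * (P0ᵀ * A1.toBlocks₁₂ * Kt) := by
            rw [h.mul_pseudoinverse, Matrix.sub_mul, Matrix.one_mul]
            simp only [Matrix.mul_assoc]
        _ = A1.toBlocks₁₂ * Kt := by rw [h2, Matrix.mul_zero, sub_zero]
    rw [mulVec_add, mulVec_mulVec, mulVec_mulVec, mulVec_mulVec, h.mul_P1_and_P0.2,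
      Matrix.mul_neg, h1, neg_mulVec]
    simp
  · rw [mulVec_add, mulVec_mulVec, mulVec_mulVec, mulVec_mulVec, matA, matK, Matrix.sub_mul,
      sub_mulVec, Matrix.mul_neg, neg_mulVec]
    simp only [Matrix.mul_assoc]
    abel

theorem isUnit_gram_matA (h : IsLayerFrame A1 S P1 P0 Λ1 Kt) :
    IsUnit (Ktᵀ * matA A1 P1 Λ1 * Kt) := by
  refine isUnit_of_mulVec_eq_zero fun w hw => h.Kt_injective w ?_
  set G := (matK A1 P0)ᵀ * matK A1 P0 with hG
  set μ := -(G⁻¹ *ᵥ (((matK A1 P0)ᵀ * matA A1 P1 Λ1 * Kt) *ᵥ w)) with hμ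
  obtain ⟨h1, h2⟩ := h.mulVec_layer w μ
  have h3 : (matA A1 P1 Λ1 * Kt) *ᵥ w + matK A1 P0 *ᵥ μ = 0 := by
    refine h.eq_zero_of_transpose_mulVec _ ?_ ?_
    · rw [mulVec_add, mulVec_mulVec, mulVec_mulVec, ← hG, hμ, mulVec_neg, mulVec_mulVec,
        mul_nonsing_inv _ ((isUnit_iff_isUnit_det _).1 h.isUnit_gram_matK), one_mulVec,
        ← Matrix.mul_assoc, add_neg_cancel]
    · rw [mulVec_add, mulVec_mulVec, mulVec_mulVec, h.orthogonal, zero_mulVec, add_zero,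
        ← Matrix.mul_assoc, hw]
  have h4 := fromBlocks_mulVec_sumElim A1.toBlocks₁₁ A1.toBlocks₁₂ A1.toBlocks₁₂ᵀ A1.toBlocks₂₂
    (-(P1 * (diagonal Λ1)⁻¹ * P1ᵀ * A1.toBlocks₁₂ * Kt) *ᵥ w + P0 *ᵥ μ) (Kt *ᵥ w)
  rw [h1, h2, h3, ← h.eq_fromBlocks] at h4
  have h5 := (mulVec_injective_iff_isUnit.2 h.isUnit) (h4.trans (by
    rw [mulVec_zero]; funext i; cases i <;> rfl : _ = A1 *ᵥ 0))
  funext i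
  exact congrFun h5 (Sum.inr i)

theorem neg (h : IsLayerFrame A1 S P1 P0 Λ1 Kt) : IsLayerFrame (-A1) S P1 P0 (-Λ1) Kt where
  isSymm := h.isSymm.neg
  isUnit := h.isUnit.neg
  posDef := h.posDef
  splitting := by
    obtain ⟨h1, h2, h3, h4⟩ := h.splitting
    refine ⟨h1, h2, ?_, fun i => neg_ne_zero.2 (h4 i)⟩
    have h5 : (-A1).toBlocks₁₁ = -A1.toBlocks₁₁ := rfl
    rw [h5, Matrix.mul_neg, Matrix.neg_mul, h3, fromBlocks_neg]
    simp
  invertible := by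
    have h5 : matK (-A1) P0 = -matK A1 P0 := Matrix.neg_mul _ _
    obtain ⟨X, hX, hX'⟩ := h.invertible
    set J : Matrix (Fin n1o ⊕ Fin s) (Fin n1o ⊕ Fin s) ℝ := fromBlocks (-1) 0 0 1 with hJdef
    have hJ : fromCols (-matK A1 P0) Kt = fromCols (matK A1 P0) Kt * J := by
      rw [hJdef, ← fromRows_fromCols_eq_fromBlocks, fromCols_mul_fromRows, mul_fromCols,
        mul_fromCols]
      ext i (j | j) <;> simp
    have hJJ : J * J = 1 := by
      rw [hJdef, fromBlocks_multiply, ← fromBlocks_one]; simp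
    refine ⟨J * X, ?_, ?_⟩
    · rw [h5, hJ, Matrix.mul_assoc, ← Matrix.mul_assoc J, hJJ, Matrix.one_mul, hX]
    · rw [h5, hJ, Matrix.mul_assoc, ← Matrix.mul_assoc X, hX', Matrix.one_mul, hJJ]
  orthogonal := by
    have h5 : matK (-A1) P0 = -matK A1 P0 := Matrix.neg_mul _ _
    rw [h5, Matrix.mul_neg, h.orthogonal, neg_zero]

theorem inv_diagonal_neg (h : IsLayerFrame A1 S P1 P0 Λ1 Kt) :
    (diagonal (-Λ1))⁻¹ = -(diagonal Λ1)⁻¹ := by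
  refine inv_eq_right_inv ?_
  have : diagonal (-Λ1) = -diagonal Λ1 := (diagonal_neg Λ1).symm
  rw [this, Matrix.neg_mul, Matrix.mul_neg, neg_neg, h.diagonal_mul_inv]

theorem matA_neg (h : IsLayerFrame A1 S P1 P0 Λ1 Kt) : matA (-A1) P1 (-Λ1) = -matA A1 P1 Λ1 := by
  have h2 : (-A1).toBlocks₁₂ = -A1.toBlocks₁₂ := rfl
  have h3 : (-A1).toBlocks₂₂ = -A1.toBlocks₂₂ := rfl
  simp only [matA, h.inv_diagonal_neg, h2, h3, transpose_neg, Matrix.mul_neg,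
    Matrix.neg_mul, neg_neg]
  abel

/-- Every vector in the kernel of `A₁₁` is a limit of stable vectors: the vectors `μ` for which
this holds with an explicit eigenvalue are those diagonalizing `Kᵀ (-S)⁻¹ K`. -/
theorem kernel_mem_limitStable (h : IsLayerFrame A1 S P1 P0 Λ1 Kt) (μ : Fin n1o → ℝ) :
    Sum.elim (P0 *ᵥ μ) 0 ∈ limitStable A1 S := by
  have hG : ((matK A1 P0)ᵀ * (-S)⁻¹ * matK A1 P0).PosDef := by
    have h1 := h.posDef.inv.conjTranspose_mul_mul_same (B := matK A1 P0)
      ((injective_iff_map_eq_zero (matK A1 P0).mulVecLin).2 h.matK_injective)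
    rwa [conjTranspose_eq_transpose_of_trivial] at h1
  obtain ⟨U, e, hU, he⟩ := exists_orthogonal_diagonalization (isSymm_of_posDef hG)
  have hUU : U * Uᵀ = 1 := mul_eq_one_comm.1 hU
  have hpos : ∀ i, 0 < e i := by
    have h1 := hG.conjTranspose_mul_mul_same (B := U) (by
      apply Function.LeftInverse.injective (g := fun x => Uᵀ *ᵥ x)
      intro x; simp [hU])
    rw [conjTranspose_eq_transpose_of_trivial, he] at h1
    exact posDef_diagonal_iff.1 h1
  have hcol : ∀ i, Sum.elim (P0 *ᵥ U.col i) 0 ∈ limitStable A1 S := by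
    intro i
    have heig : ((matK A1 P0)ᵀ * (-S)⁻¹ * matK A1 P0) *ᵥ U.col i = e i • U.col i := by
      have h1 := mul_eq_of_congruence (H := 1) (by rwa [Matrix.mul_one]) he
      rw [Matrix.one_mul] at h1
      funext j
      have h2 := congrFun (congrFun h1 j) i
      rw [mul_diagonal, mul_comm (U j i)] at h2
      exact h2
    have hSu : IsUnit (-S) := h.posDef.isUnit
    -- Compressing the second-order equation to the kernel of `A₁₁` gives `lam ^ 2 * e i = 1`.
    set lam : ℝ := -(Real.sqrt (e i))⁻¹ with hlam
    have hs : 0 < Real.sqrt (e i) := Real.sqrt_pos.2 (hpos i)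
    have hlam0 : lam < 0 := by rw [hlam]; simpa using hpos i
    have hlame : lam * e i - lam⁻¹ = 0 := by
      rw [hlam]
      field_simp
      rw [Real.sq_sqrt (hpos i).le]; ring
    set u := P0 *ᵥ U.col i with hu
    set v1 := -lam • ((-S)⁻¹ *ᵥ (A1.toBlocks₁₂ᵀ *ᵥ u)) with hv1
    set z := -(A1.toBlocks₁₂ *ᵥ v1) - lam⁻¹ • u with hz
    have hPz : P0ᵀ *ᵥ z = 0 := by
      have h1 : P0ᵀ *ᵥ (A1.toBlocks₁₂ *ᵥ v1) = -(lam * e i) • U.col i := by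
        have h2 : P0ᵀ *ᵥ (A1.toBlocks₁₂ *ᵥ ((-S)⁻¹ *ᵥ (A1.toBlocks₁₂ᵀ *ᵥ u))) =
            ((matK A1 P0)ᵀ * (-S)⁻¹ * matK A1 P0) *ᵥ U.col i := by
          rw [hu, matK, transpose_mul, transpose_transpose]
          simp only [mulVec_mulVec, Matrix.mul_assoc]
        rw [hv1, mulVec_smul, mulVec_smul, h2, heig]
        module
      rw [hz, mulVec_sub, mulVec_neg, h1, mulVec_smul, hu, mulVec_mulVec, h.transpose_mul_P.2.2.2,
        one_mulVec]
      have h3 : (lam * e i - lam⁻¹) • U.col i = 0 := by rw [hlame, zero_smul]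
      rw [← h3]
      module
    rw [h.eq_fromBlocks]
    refine mem_limitStable_of_kernel (u1 := (P1 * (diagonal Λ1)⁻¹ * P1ᵀ) *ᵥ z) (v1 := v1)
      (h.eq_fromBlocks ▸ h.isSymm) h.posDef hlam0 ?_ ?_ ?_
    · rw [hu, mulVec_mulVec, h.mul_P1_and_P0.2, zero_mulVec]
    · have h2 : S *ᵥ ((-S)⁻¹ *ᵥ (A1.toBlocks₁₂ᵀ *ᵥ u)) = -(A1.toBlocks₁₂ᵀ *ᵥ u) := by
        have h3 : -S * (-S)⁻¹ = 1 := mul_nonsing_inv _ ((isUnit_iff_isUnit_det _).1 hSu)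
        rw [mulVec_mulVec, ← neg_neg (S * (-S)⁻¹), ← Matrix.neg_mul, h3, neg_mulVec, one_mulVec]
      rw [hv1, mulVec_smul, h2]
      module
    · rw [mulVec_mulVec, h.mul_pseudoinverse, sub_mulVec, one_mulVec, ← mulVec_mulVec, hPz,
        mulVec_zero, sub_zero, hz]
      rw [show -(A1.toBlocks₁₂ *ᵥ v1) - lam⁻¹ • u + A1.toBlocks₁₂ *ᵥ v1 = -(lam⁻¹ • u) by abel,
        smul_neg, smul_smul, mul_inv_cancel₀ hlam0.ne, one_smul, neg_add_cancel]
  have hsum : (Sum.elim (P0 *ᵥ μ) 0 : Fin m ⊕ Fin r → ℝ) =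
      ∑ i, (Uᵀ *ᵥ μ) i • Sum.elim (P0 *ᵥ U.col i) 0 := by
    have h1 : μ = ∑ i, (Uᵀ *ᵥ μ) i • U.col i := by
      conv_lhs => rw [← one_mulVec μ, ← hUU, ← mulVec_mulVec, mulVec_eq_sum]
      simp [Matrix.col]
    funext j
    rw [Finset.sum_apply]
    rcases j with j | j
    · conv_lhs => rw [h1]
      simp [mulVec_sum, mulVec_smul]
    · simp
  rw [hsum]
  exact Submodule.sum_mem _ fun i _ => Submodule.smul_mem _ _ (hcol i)

theorem matN_eq (w : Fin s → ℝ) : matN A1 S P1 P0 Λ1 Kt *ᵥ w =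
    -(P1 * (diagonal Λ1)⁻¹ * P1ᵀ * A1.toBlocks₁₂ * Kt) *ᵥ w +
      P0 *ᵥ (((matK A1 P0)ᵀ * matK A1 P0)⁻¹ *ᵥ
      ((((matK A1 P0)ᵀ * S * Kt) * (Ktᵀ * S * Kt)⁻¹ * (Ktᵀ * matA A1 P1 Λ1 * Kt)
        - (matK A1 P0)ᵀ * matA A1 P1 Λ1 * Kt) *ᵥ w)) := by
  rw [matN, add_mulVec, mulVec_mulVec, mulVec_mulVec]

/-- `(N w, K̃ w)` solves the full `ε`-layer equation whenever `w` solves the reduced one. -/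
theorem layer_mem_limitStable (h : IsLayerFrame A1 S P1 P0 Λ1 Kt) {lam : ℝ} (hlam : lam < 0)
    {w : Fin s → ℝ}
    (hw : (Ktᵀ * S * Kt) *ᵥ w = lam • ((Ktᵀ * matA A1 P1 Λ1 * Kt) *ᵥ w)) :
    Sum.elim (matN A1 S P1 P0 Λ1 Kt *ᵥ w) (Kt *ᵥ w) ∈ limitStable A1 S := by
  rw [matN_eq]
  set μ := ((matK A1 P0)ᵀ * matK A1 P0)⁻¹ *ᵥ
      ((((matK A1 P0)ᵀ * S * Kt) * (Ktᵀ * S * Kt)⁻¹ * (Ktᵀ * matA A1 P1 Λ1 * Kt)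
        - (matK A1 P0)ᵀ * matA A1 P1 Λ1 * Kt) *ᵥ w) with hμ
  obtain ⟨h1, h2⟩ := h.mulVec_layer w μ
  have hE : limitStable A1 S = limitStable _ S :=
    congrArg (fun M => limitStable M S) h.eq_fromBlocks
  rw [hE]
  refine mem_limitStable_of_layer (h.eq_fromBlocks ▸ h.isSymm) (h.eq_fromBlocks ▸ h.isUnit)
    h.posDef hlam h1 ?_
  rw [h2, ← sub_eq_zero]
  refine h.eq_zero_of_transpose_mulVec _ ?_ ?_
  · have h3 : (matK A1 P0)ᵀ *ᵥ (matK A1 P0 *ᵥ μ) =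
        ((matK A1 P0)ᵀ * S * Kt) *ᵥ ((Ktᵀ * S * Kt)⁻¹ *ᵥ ((Ktᵀ * matA A1 P1 Λ1 * Kt) *ᵥ w)) -
          ((matK A1 P0)ᵀ * matA A1 P1 Λ1 * Kt) *ᵥ w := by
      rw [mulVec_mulVec, hμ, mulVec_mulVec,
        mul_nonsing_inv _ ((isUnit_iff_isUnit_det _).1 h.isUnit_gram_matK), one_mulVec,
        sub_mulVec, mulVec_mulVec, mulVec_mulVec]
    have h4 : lam • ((Ktᵀ * S * Kt)⁻¹ *ᵥ ((Ktᵀ * matA A1 P1 Λ1 * Kt) *ᵥ w)) = w := by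
      rw [← mulVec_smul, ← hw, mulVec_mulVec,
        nonsing_inv_mul _ ((isUnit_iff_isUnit_det _).1 h.isUnit_gram_Kt), one_mulVec]
    rw [mulVec_sub, mulVec_smul, mulVec_add, h3, mulVec_mulVec, ← Matrix.mul_assoc,
      add_sub_cancel, ← mulVec_smul, h4, mulVec_mulVec, mulVec_mulVec, sub_self]
  · rw [mulVec_sub, mulVec_smul, mulVec_add, mulVec_mulVec, mulVec_mulVec, h.orthogonal,
      zero_mulVec, add_zero, ← Matrix.mul_assoc, ← hw, mulVec_mulVec, mulVec_mulVec, sub_self]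

end IsLayerFrame

/-! ### The limit of the stable subspaces -/

theorem eq_zero_of_mulVec_eq_smul {ι : Type*} [Fintype ι] [DecidableEq ι] {E : Matrix ι ι ℝ}
    (hE : IsUnstableMatrix E) {a : ℝ} (ha : a ≤ 0) {x : ι → ℝ} (hx : E *ᵥ x = a • x) :
    x = 0 := by
  by_contra hx0
  have h1 : (scalar ι a - E).det = 0 := by
    refine exists_mulVec_eq_zero_iff.1 ⟨x, hx0, ?_⟩
    rw [sub_mulVec, hx, sub_eq_zero, scalar_apply, ← smul_one_eq_diagonal, smul_mulVec,
      one_mulVec]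
  have h2 : (algebraMap ℝ ℂ a) ∈ complexEigenvalues E := by
    rw [complexEigenvalues, Polynomial.mem_roots (charpoly_monic _).ne_zero, charpoly_map,
      Polynomial.IsRoot, Polynomial.eval_map_algebraMap, Polynomial.aeval_algebraMap_apply]
    rw [Polynomial.aeval_def, Algebra.algebraMap_self, Polynomial.eval₂_id, eval_charpoly, h1,
      map_zero]
  have h3 := hE _ h2
  simp at h3
  linarith

theorem eq_zero_of_vecMul_eq_smul {ι : Type*} [Fintype ι] [DecidableEq ι] {E : Matrix ι ι ℝ}
    (hE : IsUnstableMatrix E) {a : ℝ} (ha : a ≤ 0) {x : ι → ℝ} (hx : x ᵥ* E = a • x) :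
    x = 0 := by
  refine eq_zero_of_mulVec_eq_smul (E := Eᵀ) ?_ ha (by rwa [mulVec_transpose])
  intro z hz
  refine hE z ?_
  rwa [complexEigenvalues, transpose_map, charpoly_transpose] at hz

theorem map_mem_of_single {ι E : Type*} [Fintype ι] [DecidableEq ι] [AddCommGroup E] [Module ℝ E]
    (F : Submodule ℝ E) (f : (ι → ℝ) →ₗ[ℝ] E) {c : ι → ℝ}
    (h : ∀ i, c i ≠ 0 → f (Pi.single i 1) ∈ F) : f c ∈ F := by
  rw [LinearMap.pi_apply_eq_sum_univ f c]
  refine Submodule.sum_mem _ fun i _ => ?_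
  by_cases hc : c i = 0
  · rw [hc, zero_smul]; exact F.zero_mem
  · convert F.smul_mem (c i) (h i hc) using 3
    funext j
    simp [Pi.single_apply, eq_comm]

/-- Extension by zero of a function on a subtype. -/
def extendZero {ι : Type*} (P : ι → Prop) [DecidablePred P] :
    ({i // P i} → ℝ) →ₗ[ℝ] (ι → ℝ) :=
  LinearMap.pi fun i => if h : P i then LinearMap.proj ⟨i, h⟩ else 0

theorem extendZero_apply_of_not {ι : Type*} {P : ι → Prop} [DecidablePred P]
    (c : {i // P i} → ℝ) {i : ι} (h : ¬ P i) : extendZero P c i = 0 := by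
  simp [extendZero, h]

theorem extendZero_apply_coe {ι : Type*} {P : ι → Prop} [DecidablePred P]
    (c : {i // P i} → ℝ) (i : {i // P i}) : extendZero P c i = c i := by
  simp [extendZero, i.2]

theorem extendZero_injective {ι : Type*} (P : ι → Prop) [DecidablePred P] :
    Function.Injective (extendZero P) := fun c d h => by
  funext i
  rw [← extendZero_apply_coe c, ← extendZero_apply_coe d, h]

/-- The boundary value of `U` assembled from modes `α` of the outer solution, the value `μ` of the
`√ε`-layer and the value `w` of the `ε`-layer. -/
def modeMap {m r k n1o s : ℕ} (P : Matrix (Fin m) (Fin k) ℝ) (P0 : Matrix (Fin m) (Fin n1o) ℝ)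
    (N : Matrix (Fin m) (Fin s) ℝ) (Kt : Matrix (Fin r) (Fin s) ℝ) :
    ((Fin k → ℝ) × (Fin n1o → ℝ) × (Fin s → ℝ)) →ₗ[ℝ] (Fin m ⊕ Fin r → ℝ) where
  toFun x := Sum.elim (P *ᵥ x.1 + P0 *ᵥ x.2.1 + N *ᵥ x.2.2) (Kt *ᵥ x.2.2)
  map_add' x y := by
    rw [sumElim_add_sumElim]
    simp only [Prod.fst_add, Prod.snd_add, mulVec_add]
    congr 1
    abel
  map_smul' c x := by
    simp only [RingHom.id_apply, smul_sumElim, Prod.smul_fst, Prod.smul_snd, mulVec_smul, smul_add]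

theorem modeMap_apply {m r k n1o s : ℕ} (P : Matrix (Fin m) (Fin k) ℝ)
    (P0 : Matrix (Fin m) (Fin n1o) ℝ) (N : Matrix (Fin m) (Fin s) ℝ) (Kt : Matrix (Fin r) (Fin s) ℝ)
    (α : Fin k → ℝ) (μ : Fin n1o → ℝ) (w : Fin s → ℝ) :
    modeMap P P0 N Kt (α, μ, w) =
      Sum.elim (P *ᵥ α + P0 *ᵥ μ + N *ᵥ w) (Kt *ᵥ w) := rfl

namespace IsLayerFrame

variable {m r p n1o s : ℕ} {A1 : Matrix (Fin m ⊕ Fin r) (Fin m ⊕ Fin r) ℝ}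
  {S : Matrix (Fin r) (Fin r) ℝ} {P1 : Matrix (Fin m) (Fin p) ℝ}
  {P0 : Matrix (Fin m) (Fin n1o) ℝ} {Λ1 : Fin p → ℝ} {Kt : Matrix (Fin r) (Fin s) ℝ}
  {V : Matrix (Fin s) (Fin s) ℝ} {δ : Fin s → ℝ}

theorem incoming_mem_limitStable (h : IsLayerFrame A1 S P1 P0 Λ1 Kt) {c : Fin p → ℝ}
    (hc : ∀ i, ¬ 0 < Λ1 i → c i = 0) : Sum.elim (P1 *ᵥ c) 0 ∈ limitStable A1 S := by
  let f : (Fin p → ℝ) →ₗ[ℝ] (Fin m ⊕ Fin r → ℝ) :=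
    { toFun := fun c => Sum.elim (P1 *ᵥ c) 0
      map_add' := fun c d => by rw [sumElim_add_sumElim, mulVec_add, add_zero]
      map_smul' := fun a c => by rw [RingHom.id_apply, smul_sumElim, mulVec_smul, smul_zero] }
  refine map_mem_of_single _ f fun i hi => ?_
  have hpos : 0 < Λ1 i := by
    by_contra h1; exact hi (hc i h1)
  have h2 : A1.toBlocks₁₁ *ᵥ (P1 *ᵥ Pi.single i 1) = Λ1 i • (P1 *ᵥ Pi.single i 1) := by
    rw [mulVec_mulVec, h.mul_P1_and_P0.1, ← mulVec_mulVec, ← mulVec_smul]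
    congr 1
    funext j
    by_cases hj : j = i
    · subst hj; simp [mulVec_diagonal]
    · simp [hj, mulVec_diagonal]
  have h3 := mem_limitStable_of_eigenvector (S := S) (h.eq_fromBlocks ▸ h.isSymm) h.posDef hpos h2
  rwa [← h.eq_fromBlocks] at h3

theorem fastLayer_mem_limitStable (h : IsLayerFrame A1 S P1 P0 Λ1 Kt)
    (hV : Vᵀ * -(Ktᵀ * S * Kt) * V = 1)
    (hδ : Vᵀ * (Ktᵀ * matA A1 P1 Λ1 * Kt) * V = diagonal δ) {c : Fin s → ℝ}
    (hc : ∀ i, ¬ 0 < δ i → c i = 0) :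
    Sum.elim (matN A1 S P1 P0 Λ1 Kt *ᵥ (V *ᵥ c)) (Kt *ᵥ (V *ᵥ c)) ∈ limitStable A1 S := by
  let f : (Fin s → ℝ) →ₗ[ℝ] (Fin m ⊕ Fin r → ℝ) :=
    { toFun := fun c => Sum.elim (matN A1 S P1 P0 Λ1 Kt *ᵥ (V *ᵥ c)) (Kt *ᵥ (V *ᵥ c))
      map_add' := fun c d => by simp only [sumElim_add_sumElim, mulVec_add]
      map_smul' := fun a c => by simp only [RingHom.id_apply, smul_sumElim, mulVec_smul] }
  refine map_mem_of_single _ f fun i hi => ?_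
  have hpos : 0 < δ i := by
    by_contra h1; exact hi (hc i h1)
  refine h.layer_mem_limitStable (lam := -(δ i)⁻¹) (by simpa using hpos) ?_
  have h2 : diagonal δ *ᵥ Pi.single i 1 = δ i • (Pi.single i 1 : Fin s → ℝ) := by
    funext j
    by_cases hj : j = i
    · subst hj; simp [mulVec_diagonal]
    · simp [hj, mulVec_diagonal]
  rw [mulVec_mulVec, mulVec_mulVec (M := _ * matA _ _ _ * _), mul_eq_of_congruence hV hδ,
    ← mulVec_mulVec _ _ (diagonal δ), h2, mulVec_smul, smul_smul, neg_mul,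
    inv_mul_cancel₀ hpos.ne', Matrix.neg_mul, neg_mulVec]
  module

/-- The modes found so far: incoming outer modes, the whole `√ε`-layer, and the stable part of the
`ε`-layer. -/
theorem modeMap_mem_limitStable (h : IsLayerFrame A1 S P1 P0 Λ1 Kt)
    (hV : Vᵀ * -(Ktᵀ * S * Kt) * V = 1)
    (hδ : Vᵀ * (Ktᵀ * matA A1 P1 Λ1 * Kt) * V = diagonal δ) {c : Fin p → ℝ}
    (hc : ∀ i, ¬ 0 < Λ1 i → c i = 0) (μ : Fin n1o → ℝ) {d : Fin s → ℝ}
    (hd : ∀ i, ¬ 0 < δ i → d i = 0) :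
    modeMap P1 P0 (matN A1 S P1 P0 Λ1 Kt) Kt (c, μ, V *ᵥ d) ∈ limitStable A1 S := by
  have h1 := add_mem (add_mem (h.incoming_mem_limitStable hc) (h.kernel_mem_limitStable μ))
    (h.fastLayer_mem_limitStable hV hδ hd)
  rwa [sumElim_add_sumElim, sumElim_add_sumElim, zero_add, zero_add] at h1

theorem modeMap_injective (h : IsLayerFrame A1 S P1 P0 Λ1 Kt) (N : Matrix (Fin m) (Fin s) ℝ) :
    Function.Injective (modeMap P1 P0 N Kt) := by
  rw [injective_iff_map_eq_zero]
  rintro ⟨c, μ, w⟩ hx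
  rw [modeMap_apply] at hx
  have hw : w = 0 := h.Kt_injective w (funext fun i => congrFun hx (Sum.inr i))
  have h1 : P1 *ᵥ c + P0 *ᵥ μ = 0 := by
    funext i
    have := congrFun hx (Sum.inl i)
    simpa [hw] using this
  obtain ⟨h11, h10, h01, h00⟩ := h.transpose_mul_P
  have hc : c = 0 := by
    have := congrArg (fun x => P1ᵀ *ᵥ x) h1
    simpa [mulVec_add, h11, h10] using this
  have hμ : μ = 0 := by
    have := congrArg (fun x => P0ᵀ *ᵥ x) h1
    simpa [mulVec_add, h01, h00] using this
  rw [hw, hc, hμ]; rfl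

theorem card_le_finrank_limitStable (h : IsLayerFrame A1 S P1 P0 Λ1 Kt)
    (hV : Vᵀ * -(Ktᵀ * S * Kt) * V = 1)
    (hδ : Vᵀ * (Ktᵀ * matA A1 P1 Λ1 * Kt) * V = diagonal δ) :
    Fintype.card {i // 0 < Λ1 i} + (n1o + Fintype.card {i // 0 < δ i}) ≤
      Module.finrank ℝ (limitStable A1 S) := by
  let f := modeMap P1 P0 (matN A1 S P1 P0 Λ1 Kt) Kt ∘ₗ
    LinearMap.prodMap (extendZero fun i => 0 < Λ1 i)
      (LinearMap.prodMap LinearMap.id (V.mulVecLin ∘ₗ extendZero fun i => 0 < δ i))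
  have hVi : Function.Injective (V.mulVecLin ∘ₗ extendZero fun i => 0 < δ i) :=
    (mulVec_injective_iff_isUnit.2 (isUnit_of_congruence_one hV)).comp
      (extendZero_injective fun i => 0 < δ i)
  have hf : Function.Injective f :=
    (h.modeMap_injective _).comp ((extendZero_injective fun i => 0 < Λ1 i).prodMap
      (Function.injective_id.prodMap hVi))
  have hmem : ∀ x, f x ∈ limitStable A1 S := by
    rintro ⟨c, μ, d⟩
    exact h.modeMap_mem_limitStable hV hδ (c := extendZero (fun i => 0 < Λ1 i) c)
      (fun i hi => extendZero_apply_of_not c hi) μ (d := extendZero (fun i => 0 < δ i) d)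
      (fun i hi => extendZero_apply_of_not d hi)
  have := LinearMap.finrank_le_finrank_of_injective (f := f.codRestrict _ hmem)
    fun x y hxy => hf (congrArg Subtype.val hxy)
  simpa [Module.finrank_prod] using this

/-- Both `A₁` and `-A₁` contribute the lower bound of `card_le_finrank_limitStable`. As these bounds
and the upper bounds from the inertia of `±A₁` add up to the same number, all are sharp. -/
theorem finrank_limitStable_eq (h : IsLayerFrame A1 S P1 P0 Λ1 Kt)
    (hV : Vᵀ * -(Ktᵀ * S * Kt) * V = 1)
    (hδ : Vᵀ * (Ktᵀ * matA A1 P1 Λ1 * Kt) * V = diagonal δ) :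
    Module.finrank ℝ (limitStable A1 S) = numPosEigenvalues A1 ∧
      numPosEigenvalues A1 =
        Fintype.card {i // 0 < Λ1 i} + (n1o + Fintype.card {i // 0 < δ i}) := by
  have hδ' : Vᵀ * (Ktᵀ * matA (-A1) P1 (-Λ1) * Kt) * V = diagonal (-δ) := by
    rw [h.matA_neg, Matrix.mul_neg, Matrix.neg_mul, Matrix.mul_neg, Matrix.neg_mul, hδ]
    exact diagonal_neg δ
  have h1 := h.card_le_finrank_limitStable hV hδ
  have h2 := h.neg.card_le_finrank_limitStable hV hδ'
  have h3 := finrank_limitStable_le h.isSymm h.isUnit h.posDef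
  have h4 := finrank_limitStable_le h.neg.isSymm h.neg.isUnit h.posDef
  have h5 := numPosEigenvalues_add_neg h.isSymm h.isUnit
  have h6 := card_pos_add_card_neg h.splitting.2.2.2
  have h7 := card_pos_add_card_neg
    (ne_zero_of_congruence h.isUnit_gram_matA (isUnit_of_congruence_one hV) hδ)
  obtain ⟨h8, h9⟩ := h.card_eq
  simp only [Pi.neg_apply, Left.neg_pos_iff, Fintype.card_sum, Fintype.card_fin] at *
  omega

theorem numPosEigenvalues_toBlocks₁₁ (h : IsLayerFrame A1 S P1 P0 Λ1 Kt) :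
    numPosEigenvalues A1.toBlocks₁₁ = Fintype.card {i // 0 < Λ1 i} := by
  have hcard : Fintype.card (Fin m) = Fintype.card (Fin p ⊕ Fin n1o) := by
    simpa using h.card_eq.2.symm
  let e : Fin m ≃ Fin p ⊕ Fin n1o := Fintype.equivOfCardEq hcard
  have hW : IsUnit ((fromCols P1 P0).submatrix id e) := by
    refine IsUnit.of_mul_eq_one ((fromCols P1 P0)ᵀ.submatrix e id) ?_
    rw [submatrix_mul_equiv, h.splitting.2.1, submatrix_id_id]
  have hmul : A1.toBlocks₁₁ * (fromCols P1 P0).submatrix id e =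
      (fromCols P1 P0).submatrix id e * diagonal (Sum.elim Λ1 0 ∘ e) := by
    ext i j
    rw [mul_diagonal]
    have h1 := congrFun (congrFun h.mul_P1_and_P0.1 i)
    have h2 := congrFun (congrFun h.mul_P1_and_P0.2 i)
    simp only [mul_diagonal] at h1
    simp only [Matrix.mul_apply, submatrix_apply, id, Function.comp] at h1 h2 ⊢
    rcases e j with k | k
    · simpa using h1 k
    · simpa using h2 k
  rw [numPosEigenvalues_of_mul_eq hW hmul]
  refine (Fintype.card_congr ?_).symm
  refine Equiv.ofBijective (fun i => ⟨e.symm (Sum.inl i.1), by simpa using i.2⟩) ⟨?_, ?_⟩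
  · intro i j hij
    simpa [Subtype.ext_iff] using hij
  · rintro ⟨i, hi⟩
    rcases hj : e i with k | k
    · refine ⟨⟨k, by simpa [hj] using hi⟩, ?_⟩
      simp [← hj]
    · simp [hj] at hi

theorem layerMatrix_mul (h : IsLayerFrame A1 S P1 P0 Λ1 Kt)
    (hV : Vᵀ * -(Ktᵀ * S * Kt) * V = 1)
    (hδ : Vᵀ * (Ktᵀ * matA A1 P1 Λ1 * Kt) * V = diagonal δ) :
    layerMatrix A1 S P1 Λ1 Kt * V = V * diagonal fun i => -(δ i)⁻¹ := by
  have hne := ne_zero_of_congruence h.isUnit_gram_matA (isUnit_of_congruence_one hV) hδ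
  have h1 := mul_eq_of_congruence hV hδ
  have h2 : Ktᵀ * S * Kt * V =
      Ktᵀ * matA A1 P1 Λ1 * Kt * V * diagonal fun i => -(δ i)⁻¹ := by
    have h3 : (diagonal δ * diagonal fun i => -(δ i)⁻¹) = -1 := by
      rw [diagonal_mul_diagonal, ← diagonal_one, diagonal_neg]
      congr 1; funext i; simp [hne i]
    rw [h1, Matrix.mul_assoc _ (diagonal δ), h3, Matrix.neg_mul, Matrix.mul_neg, Matrix.mul_one,
      neg_neg]
  rw [layerMatrix, Matrix.mul_assoc, h2, Matrix.mul_assoc _ V, ← Matrix.mul_assoc,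
    nonsing_inv_mul _ ((isUnit_iff_isUnit_det _).1 h.isUnit_gram_matA), Matrix.one_mul]

theorem numUnstable_layerMatrix (h : IsLayerFrame A1 S P1 P0 Λ1 Kt)
    (hV : Vᵀ * -(Ktᵀ * S * Kt) * V = 1)
    (hδ : Vᵀ * (Ktᵀ * matA A1 P1 Λ1 * Kt) * V = diagonal δ) :
    numUnstable (layerMatrix A1 S P1 Λ1 Kt) = Fintype.card {i // δ i < 0} := by
  classical
  rw [numUnstable, complexEigenvalues_of_mul_eq (isUnit_of_congruence_one hV)
    (h.layerMatrix_mul hV hδ), countP_map_univ]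
  refine Fintype.card_congr (Equiv.subtypeEquivRight fun i => ?_)
  simp

/-- The kernel of `L₂ᵁ` is the stable subspace of the layer equation. -/
theorem coordinates_eq_zero_of_leftUnstable (h : IsLayerFrame A1 S P1 P0 Λ1 Kt)
    (hV : Vᵀ * -(Ktᵀ * S * Kt) * V = 1)
    (hδ : Vᵀ * (Ktᵀ * matA A1 P1 Λ1 * Kt) * V = diagonal δ) {q : ℕ}
    {L : Matrix (Fin q) (Fin s) ℝ} (hL : IsLeftUnstable (layerMatrix A1 S P1 Λ1 Kt) L)
    {c : Fin s → ℝ} (hc : L *ᵥ (V *ᵥ c) = 0) (i : Fin s) (hi : ¬ 0 < δ i) : c i = 0 := by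
  obtain ⟨hq, hLi, E, hE, hLE⟩ := hL
  have hne := ne_zero_of_congruence h.isUnit_gram_matA (isUnit_of_congruence_one hV) hδ
  rw [h.numUnstable_layerMatrix hV hδ] at hq
  let e : Fin q ≃ {i // δ i < 0} := Fintype.equivOfCardEq (by simpa using hq)
  have hLV : E * (L * V) = L * V * diagonal fun i => -(δ i)⁻¹ := by
    rw [← Matrix.mul_assoc, ← hLE, Matrix.mul_assoc, h.layerMatrix_mul hV hδ, Matrix.mul_assoc]
  have hcol : ∀ j, 0 < δ j → (L * V).col j = 0 := by
    intro j hj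
    refine eq_zero_of_mulVec_eq_smul hE (a := -(δ j)⁻¹) (by simpa using hj.le) ?_
    funext k
    have := congrFun (congrFun hLV k) j
    rw [mul_diagonal, mul_comm ((L * V) k j)] at this
    exact this
  set L' : Matrix (Fin q) (Fin q) ℝ := (L * V).submatrix id (fun k => (e k).1) with hL'
  have hunit : IsUnit L' := by
    rw [← vecMul_injective_iff_isUnit]
    refine (injective_iff_map_eq_zero L'.vecMulLinear).2 fun x hx => ?_
    have h1 : x ᵥ* (L * V) = 0 := by
      funext j
      rcases lt_or_gt_of_ne (hne j) with hj | hj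
      · have := congrFun hx (e.symm ⟨j, hj⟩)
        simpa [hL', vecMul, dotProduct] using this
      · simp only [vecMul]
        rw [show (fun i => (L * V) i j) = (L * V).col j from rfl, hcol j hj]
        simp
    have h2 : x ᵥ* L = 0 := by
      rw [← vecMul_vecMul] at h1
      exact vecMul_injective_iff_isUnit.2 (isUnit_of_congruence_one hV)
        (h1.trans (zero_vecMul V).symm)
    exact vecMul_injective_iff.2 hLi (h2.trans (zero_vecMul L).symm)
  have h3 : L' *ᵥ (fun k => c (e k)) = 0 := by
    rw [mulVec_mulVec] at hc
    rw [← hc]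
    funext k
    simp only [mulVec, dotProduct, hL', submatrix_apply, id]
    rw [Equiv.sum_comp e (fun j => (L * V) k j.1 * c j.1),
      ← Finset.sum_subtype (Finset.univ.filter fun j => δ j < 0) (by simp)
        (fun j => (L * V) k j * c j)]
    refine Finset.sum_filter_of_ne fun j _ hj => ?_
    by_contra hj'
    refine hj ?_
    rw [show (L * V) k j = 0 from
      congrFun (hcol j (lt_of_le_of_ne (not_lt.1 hj') (hne j).symm)) k, zero_mul]
  have h4 := congrFun (mulVec_injective_iff_isUnit.2 hunit (h3.trans (mulVec_zero _).symm))
    (e.symm ⟨i, lt_of_le_of_ne (not_lt.1 hi) (hne i)⟩)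
  simpa using h4

theorem exists_coordinates_of_rightUnstable (h : IsLayerFrame A1 S P1 P0 Λ1 Kt) {n1p : ℕ}
    {P1U : Matrix (Fin m) (Fin n1p) ℝ} (hP : IsRightUnstable A1.toBlocks₁₁ P1U)
    (α : Fin n1p → ℝ) :
    ∃ c : Fin p → ℝ, (∀ i, ¬ 0 < Λ1 i → c i = 0) ∧ P1U *ᵥ α = P1 *ᵥ c := by
  obtain ⟨-, -, E, hE, hAE⟩ := hP
  have hsymm : A1.toBlocks₁₁ᵀ = A1.toBlocks₁₁ := by
    ext i j; exact h.isSymm.apply _ _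
  have h1 : (P1ᵀ * P1U) * E = diagonal Λ1 * (P1ᵀ * P1U) := by
    rw [Matrix.mul_assoc, ← hAE, ← Matrix.mul_assoc, ← Matrix.mul_assoc]
    congr 1
    rw [← hsymm, ← transpose_mul, h.mul_P1_and_P0.1, transpose_mul, diagonal_transpose]
  have h0 : (P0ᵀ * P1U) * E = 0 := by
    rw [Matrix.mul_assoc, ← hAE, ← Matrix.mul_assoc, ← hsymm, ← transpose_mul, h.mul_P1_and_P0.2,
      transpose_zero, Matrix.zero_mul]
  have h2 : P0ᵀ * P1U = 0 := by
    ext i j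
    refine congrFun (eq_zero_of_vecMul_eq_smul hE le_rfl (x := (P0ᵀ * P1U).row i) ?_) j
    rw [zero_smul]
    exact congrFun h0 i
  refine ⟨(P1ᵀ * P1U) *ᵥ α, fun i hi => ?_, ?_⟩
  · have h3 : (P1ᵀ * P1U).row i = 0 := by
      refine eq_zero_of_vecMul_eq_smul hE (not_lt.1 hi) ?_
      funext j
      have := congrFun (congrFun h1 i) j
      rw [diagonal_mul] at this
      exact this
    change (P1ᵀ * P1U).row i ⬝ᵥ α = 0
    rw [h3, zero_dotProduct]
  · rw [mulVec_mulVec, ← Matrix.mul_assoc, eq_sub_of_add_eq h.P1_add_P0, Matrix.sub_mul,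
      Matrix.one_mul, Matrix.mul_assoc P0, h2, Matrix.mul_zero, sub_zero]

end IsLayerFrame

/-! ### The Generalized Kreiss Condition on the limit subspace -/

theorem map_ofReal_mul {ι κ μ : Type*} [Fintype κ] (M : Matrix ι κ ℝ) (N : Matrix κ μ ℝ) :
    (M * N).map Complex.ofReal = M.map Complex.ofReal * N.map Complex.ofReal :=
  Matrix.map_mul (f := Complex.ofRealHom)

theorem det_map_ofReal {ι : Type*} [Fintype ι] [DecidableEq ι] (M : Matrix ι ι ℝ) :
    (M.map Complex.ofReal).det = (M.det : ℂ) :=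
  (Complex.ofRealHom.map_det M).symm

theorem conjTranspose_map_ofReal {ι κ : Type*} (M : Matrix ι κ ℝ) :
    (M.map Complex.ofReal)ᴴ = Mᵀ.map Complex.ofReal := by
  ext i j
  simp

/-- At `ω = 0`, `η = 1` and `ξ = τ ^ 2` the symbol is the real matrix `-A₁⁻¹ (ξ I - Q)`. -/
theorem symbolM_eq {m r d' : ℕ} {A1 : Matrix (Fin m ⊕ Fin r) (Fin m ⊕ Fin r) ℝ}
    (hA1 : IsUnit A1) (Aj : Fin d' → Matrix (Fin m ⊕ Fin r) (Fin m ⊕ Fin r) ℝ)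
    (S : Matrix (Fin r) (Fin r) ℝ) (τ : ℝ) :
    symbolM A1 Aj S ((τ ^ 2 : ℝ) : ℂ) 0 1 =
      (-(A1⁻¹ * dampingMatrix (Fin m) S τ)).map Complex.ofReal := by
  have h1 : (A1.map Complex.ofReal)⁻¹ = A1⁻¹.map Complex.ofReal := by
    refine inv_eq_right_inv ?_
    rw [← map_ofReal_mul, mul_nonsing_inv _ ((isUnit_iff_isUnit_det _).1 hA1)]
    exact Matrix.map_one _ Complex.ofReal_zero Complex.ofReal_one
  rw [symbolM, h1, ← Matrix.mul_neg, map_ofReal_mul]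
  congr 1
  ext (i | i) (j | j)
  · by_cases hij : i = j <;> simp [sourceMatrix, dampingMatrix, hij]
  · simp [sourceMatrix, dampingMatrix]
  · simp [sourceMatrix, dampingMatrix]
  · by_cases hij : i = j <;> simp [sourceMatrix, dampingMatrix, hij]

/-- A real basis of the stable subspace of the pencil is a right-stable matrix of the symbol at
`ω = 0`, `η = 1`, `ξ = τ ^ 2`. -/
theorem isRightStable_of_mem_pencilStable {m r d' np : ℕ}
    {A1 : Matrix (Fin m ⊕ Fin r) (Fin m ⊕ Fin r) ℝ} (hA : A1.IsSymm) (hA1 : IsUnit A1)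
    (Aj : Fin d' → Matrix (Fin m ⊕ Fin r) (Fin m ⊕ Fin r) ℝ) {S : Matrix (Fin r) (Fin r) ℝ}
    (hS : (-S).PosDef) (hnp : np = numPosEigenvalues A1) {τ : ℝ} (hτ : 0 < τ)
    {R : Matrix (Fin m ⊕ Fin r) (Fin np) ℝ}
    (hR : ∀ j, R.col j ∈ pencilStable A1 (dampingMatrix (Fin m) S τ)) (hdet : (Rᵀ * R).det ≠ 0) :
    IsRightStable (symbolM A1 Aj S ((τ ^ 2 : ℝ) : ℂ) 0 1) (R.map Complex.ofReal) := by
  obtain ⟨V, δ, hV, hδ⟩ := exists_simultaneous_diagonalization hA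
    (posDef_dampingMatrix (ι := Fin m) hS hτ)
  have hVu := isUnit_of_congruence_one hV
  have hne := ne_zero_of_congruence hA1 hVu hδ
  rw [numPosEigenvalues_eq_card_of_congruence hA hA1 hVu hδ] at hnp
  rw [symbolM_eq hA1]
  set M := -(A1⁻¹ * dampingMatrix (Fin m) S τ) with hM
  have hMV : M * V = V * diagonal fun i => -(δ i)⁻¹ := by
    have h1 := mul_eq_of_congruence hV hδ
    have h2 : dampingMatrix (Fin m) S τ * V = A1 * V * diagonal fun i => (δ i)⁻¹ := by
      rw [h1, Matrix.mul_assoc _ (diagonal δ), diagonal_mul_diagonal]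
      simp [hne]
    rw [hM, Matrix.neg_mul, Matrix.mul_assoc, h2, Matrix.mul_assoc A1, ← Matrix.mul_assoc,
      nonsing_inv_mul _ ((isUnit_iff_isUnit_det _).1 hA1), Matrix.one_mul, ← Matrix.mul_neg,
      diagonal_neg]
  -- `R` is the basis `Vs` of stable eigenvectors times an invertible matrix `C`, hence
  -- `M R = R (C⁻¹ D C)` with `D` the diagonal matrix of the stable eigenvalues.
  choose c hc hRc using fun j => (mem_pencilStable_iff hV hδ _).1 (hR j)
  let e : Fin np ≃ {i // 0 < δ i} := Fintype.equivOfCardEq (by simpa using hnp)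
  let Vs : Matrix (Fin m ⊕ Fin r) (Fin np) ℝ := V.submatrix id fun k => (e k).1
  let C : Matrix (Fin np) (Fin np) ℝ := of fun k j => c j (e k)
  let D : Matrix (Fin np) (Fin np) ℝ := diagonal fun k => -(δ (e k))⁻¹
  have hRV : R = Vs * C := by
    ext i j
    have h1 : R i j = ∑ k, V i k * c j k := congrFun (hRc j) i
    rw [h1, Matrix.mul_apply]
    simp only [Vs, C, submatrix_apply, id, of_apply]
    rw [Equiv.sum_comp e (fun k => V i k.1 * c j k.1),
      ← Finset.sum_subtype (Finset.univ.filter fun k => 0 < δ k) (by simp)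
        (fun k => V i k * c j k)]
    refine (Finset.sum_filter_of_ne fun k _ hk => ?_).symm
    by_contra hk'
    exact hk (by rw [hc j k hk', mul_zero])
  have hMVs : M * Vs = Vs * D := by
    ext i k
    have h1 := congrFun (congrFun hMV i) (e k).1
    rw [mul_diagonal] at h1 ⊢
    exact h1
  have hC : IsUnit C := by
    refine isUnit_of_mulVec_eq_zero fun x hx => ?_
    have h1 : (Rᵀ * R) *ᵥ x = 0 := by
      rw [← mulVec_mulVec, hRV, ← mulVec_mulVec _ Vs, hx, mulVec_zero, mulVec_zero]
    exact (mulVec_injective_iff_isUnit.2 ((isUnit_iff_isUnit_det _).2 hdet.isUnit))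
      (h1.trans (mulVec_zero _).symm)
  have hCdet := (isUnit_iff_isUnit_det _).1 hC
  have hMc : M.map Complex.ofReal * V.map Complex.ofReal = V.map Complex.ofReal *
      diagonal fun i => (((-(δ i)⁻¹ : ℝ)) : ℂ) := by
    rw [← map_ofReal_mul, hMV, map_ofReal_mul, diagonal_map Complex.ofReal_zero]
  have hVc : IsUnit (V.map Complex.ofReal) := by
    rw [isUnit_iff_isUnit_det, det_map_ofReal]
    exact ((isUnit_iff_isUnit_det _).1 hVu).map Complex.ofRealHom
  refine ⟨?_, ?_, (C⁻¹ * D * C).map Complex.ofReal, ?_, ?_⟩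
  · classical
    rw [numStable, complexEigenvalues_of_mul_eq hVc hMc, countP_map_univ, hnp]
    refine Fintype.card_congr (Equiv.subtypeEquivRight fun i => ?_)
    simp
  · rw [← mulVec_injective_iff]
    refine (injective_iff_map_eq_zero (R.map Complex.ofReal).mulVecLin).2 fun x hx => ?_
    have h1 : (Rᵀ * R).map Complex.ofReal *ᵥ x = 0 := by
      rw [map_ofReal_mul, ← mulVec_mulVec]
      rw [mulVecLin_apply] at hx
      rw [hx, mulVec_zero]
    have h2 : IsUnit ((Rᵀ * R).map Complex.ofReal) := by
      rw [isUnit_iff_isUnit_det, det_map_ofReal]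
      exact hdet.isUnit.map Complex.ofRealHom
    exact (mulVec_injective_iff_isUnit.2 h2) (h1.trans (mulVec_zero _).symm)
  · have hCu : IsUnit (C⁻¹) := by
      rw [isUnit_iff_isUnit_det]; exact isUnit_nonsing_inv_det _ hCdet
    have h1 : (C⁻¹ * D * C) * C⁻¹ = C⁻¹ * D := by
      rw [Matrix.mul_assoc, mul_nonsing_inv _ hCdet, Matrix.mul_one]
    intro z hz
    have h2 : complexEigenvalues ((C⁻¹ * D * C).map Complex.ofReal) =
        complexEigenvalues (C⁻¹ * D * C) := by
      rw [complexEigenvalues, complexEigenvalues, Matrix.map_map]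
      rfl
    rw [h2, complexEigenvalues_of_mul_eq hCu h1] at hz
    obtain ⟨k, -, rfl⟩ := Multiset.mem_map.1 hz
    simpa using (e k).2
  · rw [← map_ofReal_mul, ← map_ofReal_mul]
    congr 1
    rw [hRV, ← Matrix.mul_assoc, hMVs, Matrix.mul_assoc Vs C, ← Matrix.mul_assoc C,
      ← Matrix.mul_assoc C, mul_nonsing_inv _ hCdet, Matrix.one_mul, Matrix.mul_assoc]

theorem GKC.bound_of_mem_pencilStable {m r d' np : ℕ}
    {A1 : Matrix (Fin m ⊕ Fin r) (Fin m ⊕ Fin r) ℝ} (hA : A1.IsSymm) (hA1 : IsUnit A1)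
    {Aj : Fin d' → Matrix (Fin m ⊕ Fin r) (Fin m ⊕ Fin r) ℝ} {S : Matrix (Fin r) (Fin r) ℝ}
    (hS : (-S).PosDef) (hnp : np = numPosEigenvalues A1) {B : Matrix (Fin np) (Fin m ⊕ Fin r) ℝ}
    (hGKC : GKC A1 Aj S B) :
    ∃ cK : ℝ, 0 < cK ∧ ∀ τ : ℝ, 0 < τ → ∀ R : Matrix (Fin m ⊕ Fin r) (Fin np) ℝ,
      (∀ j, R.col j ∈ pencilStable A1 (dampingMatrix (Fin m) S τ)) →
        cK * Real.sqrt (Rᵀ * R).det ≤ |(B * R).det| := by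
  obtain ⟨cK, hcK, hK⟩ := hGKC
  refine ⟨cK, hcK, fun τ hτ R hR => ?_⟩
  by_cases hdet : (Rᵀ * R).det = 0
  · -- For dependent columns the left-hand side is zero.
    rw [hdet, Real.sqrt_zero, mul_zero]; exact abs_nonneg _
  · have h1 := hK 1 0 ((τ ^ 2 : ℝ) : ℂ) zero_le_one (by rw [Complex.ofReal_re]; positivity) _
      (isRightStable_of_mem_pencilStable hA hA1 Aj hS hnp hτ hR hdet)
    rwa [conjTranspose_map_ofReal, ← map_ofReal_mul, ← map_ofReal_mul, det_map_ofReal,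
      det_map_ofReal, Complex.ofReal_re, Complex.norm_real, Real.norm_eq_abs] at h1

/-- The uniformity of the Kreiss constant lets the bound pass to the limit `τ → 0`. -/
theorem GKC.eq_zero_of_mem_limitStable {m r d' np : ℕ}
    {A1 : Matrix (Fin m ⊕ Fin r) (Fin m ⊕ Fin r) ℝ} (hA : A1.IsSymm) (hA1 : IsUnit A1)
    {Aj : Fin d' → Matrix (Fin m ⊕ Fin r) (Fin m ⊕ Fin r) ℝ} {S : Matrix (Fin r) (Fin r) ℝ}
    (hS : (-S).PosDef) (hnp : np = numPosEigenvalues A1) {B : Matrix (Fin np) (Fin m ⊕ Fin r) ℝ}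
    (hGKC : GKC A1 Aj S B) (hdim : Module.finrank ℝ (limitStable A1 S) = np)
    {x : Fin m ⊕ Fin r → ℝ} (hx : x ∈ limitStable A1 S) (hBx : B *ᵥ x = 0) : x = 0 := by
  obtain ⟨cK, hcK, hK⟩ := GKC.bound_of_mem_pencilStable hA hA1 hS hnp hGKC
  let b := Module.finBasisOfFinrankEq ℝ (limitStable A1 S) hdim
  choose y hy hy' using fun j => (b j).2
  let R0 : Matrix (Fin m ⊕ Fin r) (Fin np) ℝ := of fun i j => (b j).1 i
  let R : ℝ → Matrix (Fin m ⊕ Fin r) (Fin np) ℝ := fun τ => of fun i j => y j τ i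
  have hR0 : ∀ c : Fin np → ℝ, R0 *ᵥ c = (∑ j, c j • b j : limitStable A1 S) := by
    intro c
    funext i
    simp [R0, mulVec, dotProduct, mul_comm]
  have hR : Tendsto R (𝓝[>] 0) (𝓝 R0) := by
    refine tendsto_pi_nhds.2 fun i => tendsto_pi_nhds.2 fun j => ?_
    exact tendsto_pi_nhds.1 (hy j) i
  have hcont1 : Continuous fun R : Matrix (Fin m ⊕ Fin r) (Fin np) ℝ =>
      cK * Real.sqrt (Rᵀ * R).det := by fun_prop
  have hcont2 : Continuous fun R : Matrix (Fin m ⊕ Fin r) (Fin np) ℝ => |(B * R).det| := by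
    fun_prop
  have hlim : cK * Real.sqrt (R0ᵀ * R0).det ≤ |(B * R0).det| := by
    refine le_of_tendsto_of_tendsto ((hcont1.tendsto R0).comp hR) ((hcont2.tendsto R0).comp hR) ?_
    filter_upwards [self_mem_nhdsWithin] with τ hτ
    exact hK τ hτ (R τ) fun j => hy' j τ hτ
  have hinj : Function.Injective R0.mulVec := by
    refine (injective_iff_map_eq_zero R0.mulVecLin).2 fun c hc => ?_
    rw [mulVecLin_apply, hR0] at hc
    have h1 : ∑ j, c j • b j = 0 := Subtype.ext hc
    funext j
    exact Fintype.linearIndependent_iff.1 b.linearIndependent c h1 j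
  have hpos : 0 < (R0ᵀ * R0).det := by
    have h1 := PosDef.conjTranspose_mul_self R0 hinj
    rw [conjTranspose_eq_transpose_of_trivial] at h1
    exact h1.det_pos
  have hdet : (B * R0).det ≠ 0 := by
    rw [← abs_pos]
    exact (mul_pos hcK (Real.sqrt_pos.2 hpos)).trans_le hlim
  have hxc : x = R0 *ᵥ (b.repr ⟨x, hx⟩) := by
    rw [hR0, b.sum_repr]
  rw [hxc, mulVec_mulVec] at hBx
  have h2 := (mulVec_injective_iff_isUnit.2 ((isUnit_iff_isUnit_det _).2 hdet.isUnit))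
    (hBx.trans (mulVec_zero _).symm)
  rw [hxc, h2, mulVec_zero]

/-! ### Invertibility of the boundary matrix -/

theorem isInvertibleMatrix_of_injective {ι κ : Type*} [Fintype ι] [DecidableEq ι] [Fintype κ]
    [DecidableEq κ] {D : Matrix ι κ ℝ} (hcard : Fintype.card ι = Fintype.card κ)
    (hD : ∀ x, D *ᵥ x = 0 → x = 0) : IsInvertibleMatrix D := by
  let e : κ ≃ ι := (Fintype.equivOfCardEq hcard).symm
  have hunit : IsUnit (D.submatrix e id) := by
    refine isUnit_of_mulVec_eq_zero fun x hx => hD x ?_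
    funext i
    simpa [mulVec] using congrFun hx (e.symm i)
  obtain ⟨X, hX⟩ := hunit.exists_right_inv
  have hX' := mul_eq_one_comm.1 hX
  refine ⟨X.submatrix id e.symm, ?_, ?_⟩
  · have h1 : D * X.submatrix id e.symm = (D.submatrix e id * X).submatrix e.symm e.symm := by
      ext i j
      simp [Matrix.mul_apply]
    rw [h1, hX, submatrix_one_equiv]
  · have h1 : X.submatrix id e.symm * D = X * D.submatrix e id := by
      ext i j
      simp only [Matrix.mul_apply, submatrix_apply, id]
      exact Equiv.sum_comp e.symm (fun k => X i k * D (e k) j) ▸ by simp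
    rw [h1, hX']

theorem IsInvertibleMatrix.existsUnique {ι κ : Type*} [Fintype ι] [DecidableEq ι] [Fintype κ]
    [DecidableEq κ] {D : Matrix ι κ ℝ} (hD : IsInvertibleMatrix D) (y : ι → ℝ) :
    ∃! x, D *ᵥ x = y := by
  obtain ⟨X, hX, hX'⟩ := hD
  refine ⟨X *ᵥ y, by simp [hX], fun x hx => ?_⟩
  rw [← hx, mulVec_mulVec, hX', one_mulVec]

/-- The boundary matrix evaluates `B` on the boundary value assembled from the modes, together with
the condition that the `ε`-layer has no growing part. -/
theorem boundaryMatrix_mulVec {m r np n1p n1o s q : ℕ} (B : Matrix (Fin np) (Fin m ⊕ Fin r) ℝ)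
    (P1U : Matrix (Fin m) (Fin n1p) ℝ) (P0 : Matrix (Fin m) (Fin n1o) ℝ)
    (N : Matrix (Fin m) (Fin s) ℝ) (Kt : Matrix (Fin r) (Fin s) ℝ)
    (L2U : Matrix (Fin q) (Fin s) ℝ) (α : Fin n1p → ℝ) (μ : Fin n1o → ℝ) (w : Fin s → ℝ) :
    boundaryMatrix B P1U P0 N Kt L2U *ᵥ Sum.elim α (Sum.elim μ w) =
      Sum.elim (B *ᵥ modeMap P1U P0 N Kt (α, μ, w)) (L2U *ᵥ w) := by
  have hB : B = fromCols B.toCols₁ B.toCols₂ := (fromCols_toCols B).symm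
  rw [boundaryMatrix, fromRows_mulVec]
  simp only [fromCols_mulVec_sumElim, zero_mulVec, zero_add]
  congr 1
  conv_rhs => rw [hB, modeMap_apply, fromCols_mulVec_sumElim]
  simp only [mulVec_add, add_mulVec, mulVec_mulVec, add_assoc]

theorem lemma4p6 {m r d' np n1p n1m n1o p s q : ℕ}
    -- coefficient matrices: `A1` for the normal direction, `Aj` for the tangential ones
    (A1 : Matrix (Fin m ⊕ Fin r) (Fin m ⊕ Fin r) ℝ)
    (Aj : Fin d' → Matrix (Fin m ⊕ Fin r) (Fin m ⊕ Fin r) ℝ)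
    (S : Matrix (Fin r) (Fin r) ℝ)
    (B : Matrix (Fin np) (Fin m ⊕ Fin r) ℝ)
    (hA1 : A1.IsSymm) (hAj : ∀ j, (Aj j).IsSymm) (hS : (-S).PosDef)
    -- the boundary is non-characteristic for the relaxation system
    -- and characteristic for the equilibrium system
    (hA1inv : IsUnit A1) (hchar : ¬ IsUnit A1.toBlocks₁₁)
    -- numbers of eigenvalues
    (hnp : np = numPosEigenvalues A1)
    (hn1p : n1p = numPosEigenvalues A1.toBlocks₁₁)
    (hn1o : n1o = numZeroEigenvalues A1.toBlocks₁₁)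
    -- boundary matrix
    (hB : B.rank = np) (hGKC : GKC A1 Aj S B)
    -- spectral splitting of `A₁₁`
    (P1 : Matrix (Fin m) (Fin p) ℝ) (P0 : Matrix (Fin m) (Fin n1o) ℝ) (Λ1 : Fin p → ℝ)
    (hP : IsEigenSplitting A1.toBlocks₁₁ P1 P0 Λ1)
    (P1U : Matrix (Fin m) (Fin n1p) ℝ) (hP1U : IsRightUnstable A1.toBlocks₁₁ P1U)
    (P1S : Matrix (Fin m) (Fin n1m) ℝ) (hP1S : IsRightStable A1.toBlocks₁₁ P1S)
    -- the complement `K̃` of `K`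
    (Kt : Matrix (Fin r) (Fin s) ℝ)
    (hKt : IsInvertibleMatrix (fromCols (matK A1 P0) Kt)) (hKtK : Ktᵀ * matK A1 P0 = 0)
    -- left-unstable matrix of the layer equation
    (L2U : Matrix (Fin q) (Fin s) ℝ)
    (hL2U : IsLeftUnstable (layerMatrix A1 S P1 Λ1 Kt) L2U) :
    -- the matrix is square of size `n1p + r`
    np + q = n1p + r ∧ n1p + (n1o + s) = n1p + r ∧
    -- it is invertible
    IsInvertibleMatrix (boundaryMatrix B P1U P0 (matN A1 S P1 P0 Λ1 Kt) Kt L2U) ∧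
    -- the linear system for the boundary values is uniquely solvable
    ∀ (b : Fin np → ℝ) (αS : Fin n1m → ℝ) (α0 : Fin n1o → ℝ),
      ∃! x : (Fin n1p → ℝ) × (Fin n1o → ℝ) × (Fin s → ℝ),
        boundaryMatrix B P1U P0 (matN A1 S P1 P0 Λ1 Kt) Kt L2U *ᵥ
            Sum.elim x.1 (Sum.elim x.2.1 x.2.2) =
          Sum.elim (b - B.toCols₁ *ᵥ (P1S *ᵥ αS) - B.toCols₁ *ᵥ (P0 *ᵥ α0)) 0 := by
  have h : IsLayerFrame A1 S P1 P0 Λ1 Kt := ⟨hA1, hA1inv, hS, hP, hKt, hKtK⟩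
  obtain ⟨V, δ, hV, hδ⟩ := exists_simultaneous_diagonalization
    (isSymm_transpose_mul_mul h.isSymm_matA Kt) h.posDef_gram_Kt
  obtain ⟨hdim, hcount⟩ := h.finrank_limitStable_eq hV hδ
  have hVu := isUnit_of_congruence_one hV
  have hsum := card_pos_add_card_neg (ne_zero_of_congruence h.isUnit_gram_matA hVu hδ)
  have hq : q = Fintype.card {i // δ i < 0} := hL2U.1.trans (h.numUnstable_layerMatrix hV hδ)
  have hn1p' := hn1p.trans h.numPosEigenvalues_toBlocks₁₁
  have hr := h.card_eq.1
  rw [Fintype.card_fin] at hsum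
  have hsize : np + q = n1p + r := by omega
  have hinv : IsInvertibleMatrix (boundaryMatrix B P1U P0 (matN A1 S P1 P0 Λ1 Kt) Kt L2U) := by
    refine isInvertibleMatrix_of_injective (by simp; omega) fun x hx => ?_
    obtain ⟨α, μ, w, rfl⟩ : ∃ α μ w, x = Sum.elim α (Sum.elim μ w) :=
      ⟨x ∘ Sum.inl, x ∘ Sum.inr ∘ Sum.inl, x ∘ Sum.inr ∘ Sum.inr, by
        funext i; rcases i with i | i | i <;> rfl⟩
    rw [boundaryMatrix_mulVec] at hx
    have hx1 : B *ᵥ modeMap P1U P0 (matN A1 S P1 P0 Λ1 Kt) Kt (α, μ, w) = 0 :=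
      funext fun i => congrFun hx (Sum.inl i)
    have hx2 : L2U *ᵥ w = 0 := funext fun i => congrFun hx (Sum.inr i)
    -- The kernel of `L₂ᵁ` is stable for the layer equation, so the modes lie in the limit subspace.
    obtain ⟨d, rfl⟩ := (mulVec_surjective_iff_isUnit.2 hVu) w
    have hd := h.coordinates_eq_zero_of_leftUnstable hV hδ hL2U hx2
    obtain ⟨c, hc, hαc⟩ := h.exists_coordinates_of_rightUnstable hP1U α
    have hmode : modeMap P1U P0 (matN A1 S P1 P0 Λ1 Kt) Kt (α, μ, V *ᵥ d) =
        modeMap P1 P0 (matN A1 S P1 P0 Λ1 Kt) Kt (c, μ, V *ᵥ d) := by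
      rw [modeMap_apply, modeMap_apply, hαc]
    rw [hmode] at hx1
    have h0 := GKC.eq_zero_of_mem_limitStable hA1 hA1inv hS hnp hGKC (hdim.trans hnp.symm)
      (h.modeMap_mem_limitStable hV hδ hc μ hd) hx1
    have h1 := h.modeMap_injective _ (h0.trans (map_zero _).symm)
    simp only [Prod.mk_eq_zero] at h1
    obtain ⟨hc0, hμ0, hw0⟩ := h1
    have hα0 : α = 0 := (mulVec_injective_iff.2 hP1U.2.1) (by
      change P1U *ᵥ α = P1U *ᵥ 0
      rw [hαc, hc0, mulVec_zero, mulVec_zero])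
    rw [hα0, hμ0]
    funext i
    rcases i with i | i | i
    · rfl
    · rfl
    · exact congrFun hw0 i
  refine ⟨hsize, by omega, hinv, fun b αS α0 => ?_⟩
  obtain ⟨x, hx, huniq⟩ := hinv.existsUnique
    (Sum.elim (b - B.toCols₁ *ᵥ (P1S *ᵥ αS) - B.toCols₁ *ᵥ (P0 *ᵥ α0)) 0)
  refine ⟨(x ∘ Sum.inl, x ∘ Sum.inr ∘ Sum.inl, x ∘ Sum.inr ∘ Sum.inr), ?_, ?_⟩
  · convert hx using 2
    funext i; rcases i with i | i | i <;> rfl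
  · rintro ⟨α, μ, w⟩ hy
    rw [← huniq _ hy]
    rfl
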